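/- **Conventions.** An oriented matroid $\mathcal M=(E,\mathcal V^*)$ on a finite set $E$ is given by its set of covectors $\mathcal V^*\subseteq\{+,-,0\}^E$ satisfying the covector axioms: (L1) $\mathbf 0\in\mathcal V^*$; (L2) $X\in\mathcal V^*\Rightarrow -X\in\mathcal V^*$; (L3) $X,Y\in\mathcal V^*\Rightarrow X\circ Y\in\mathcal V^*$; (L4) if $X,Y\in\mathcal V^*$ and $e\in S(X,Y)$, there is $Z\in\mathcal V^*$ with $Z_e=0$ and $Z_f=(X\circ Y)_f=(Y\circ X)_f$ for all $f\notin S(X,Y)$. Here $(X\circ Y)_e=X_e$ if $X_e\ne0$ and $(X\circ Y)_e=Y_e$ otherwise, and $S(X,Y)=\{e: X_e=-Y_e\neq 0\}$. Write $X\preceq Y$ if for every $e$ either $X_e=Y_e$ or $X_e=0$. The cocircuits $\mathcal C^*(\mathcal M)$ are the $\preceq$-minimal non-zero covectors. The underlying matroid of $\mathcal M$ is the matroid on $E$ whose flats are the zero sets of the covectors; the rank of $\mathcal M$ is the rank of this matroid, and $\mathcal M$ is uniform if this matroid is uniform. $\mathcal M$ is acyclic if the all-positive sign vector is a covector. Oriented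 matroids $\mathcal M$ on $E$ and $\mathcal N$ on $F$ are relabeling equivalent if there is a bijection $\phi:E\to F$ such that a sign vector $X$ on $E$ is a covector of $\mathcal M$ if and only if its image $\phi(X)$ is a covector of $\mathcal N$. The cocircuit graph $CG(\mathcal M)$ has vertex set $\mathcal C^*(\mathcal M)$; distinct cocircuits $X,Y$ are adjacent if and only if $S(X,Y)=\emptyset$ and no cocircuit $Z\ne X,Y$ satisfies $Z\preceq X\circ Y$. The graph $G(\mathcal M)$ is obtained from $CG(\mathcal M)$ by adding two new vertices $v_+,v_-$, joining $v_+$ to all non-negative cocircuits and $v_-$ to all non-positive cocircuits. **Proposition.** Let $\mathcal M$ and $\mathcal N$ be uniform oriented matroids (on arbitrary finite ground sets), and suppose that $\mathcal M$ is acyclic and of rank at least $2$. Then $\mathcal M$ and $\mathcal N$ are relabeling equivalent if and only if the graphs $G(\mathcal M)$ and $G(\mathcal N)$ are isomorphic. -/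

import Mathlib

/-- A sign vector on `E`, that is an element of `{+, -, 0}^E`. -/
abbrev SignVec (E : Type*) := E → SignType

namespace SignVec

variable {E : Type*}

/-- The composition `X ∘ Y` of two sign vectors. -/
def comp (X Y : SignVec E) : SignVec E := fun e => if X e ≠ 0 then X e else Y e

/-- The separation set `S(X, Y)`. -/
def sep (X Y : SignVec E) : Set E := {e | X e = -Y e ∧ X e ≠ 0}

/-- The conformal order `X ⪯ Y` on sign vectors. -/
def Conf (X Y : SignVec E) : Prop := ∀ e, X e = Y e ∨ X e = 0

end SignVec

/-- An oriented matroid on the ground set `E`, given by its covectors. -/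
structure OrientedMatroid (E : Type*) where
  /-- the set of covectors -/
  covectors : Set (SignVec E)
  zero_mem : (0 : SignVec E) ∈ covectors
  neg_mem : ∀ X ∈ covectors, -X ∈ covectors
  comp_mem : ∀ X ∈ covectors, ∀ Y ∈ covectors, X.comp Y ∈ covectors
  elim : ∀ X ∈ covectors, ∀ Y ∈ covectors, ∀ e ∈ X.sep Y,
    ∃ Z ∈ covectors, Z e = 0 ∧ ∀ f ∉ X.sep Y, Z f = X.comp Y f ∧ Z f = Y.comp X f

namespace OrientedMatroid

variable {E F : Type*}

/-- The closure operator of the underlying matroid: the closed sets are the zero sets of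
covectors, so `e` is in the closure of `A` iff every covector vanishing on `A` vanishes at `e`. -/
def cl (M : OrientedMatroid E) (A : Set E) : Set E :=
  {e | ∀ X ∈ M.covectors, (∀ a ∈ A, X a = 0) → X e = 0}

theorem subset_cl (M : OrientedMatroid E) (A : Set E) : A ⊆ M.cl A :=
  fun e he _ _ h => h e he

theorem cl_mono (M : OrientedMatroid E) {A B : Set E} (h : A ⊆ B) : M.cl A ⊆ M.cl B :=
  fun _ he X hX hB => he X hX fun a ha => hB a (h ha)

theorem cl_subset_cl (M : OrientedMatroid E) {A B : Set E} (h : A ⊆ M.cl B) :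
    M.cl A ⊆ M.cl B :=
  fun _ he X hX hB => he X hX fun _ ha => h ha X hX hB

theorem cl_exchange (M : OrientedMatroid E) {A : Set E} {e f : E}
    (h1 : e ∈ M.cl (insert f A)) (h2 : e ∉ M.cl A) : f ∈ M.cl (insert e A) := by
  simp only [cl, Set.mem_ofPred_eq, not_forall] at h2
  obtain ⟨X, hX, hXA, hXe⟩ := h2
  have hXf : X f ≠ 0 := by
    intro hf
    refine hXe (h1 X hX ?_)
    rintro a (rfl | ha)
    · exact hf
    · exact hXA a ha
  intro Y hY hYA
  by_contra hYf
  have hYe : Y e = 0 := hYA e (Set.mem_insert _ _)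
  -- after replacing `Y` by its negative if needed, `f` separates `X` and `Y`
  obtain ⟨W, hW, hWA, hWe, hWf⟩ : ∃ W ∈ M.covectors, (∀ a ∈ A, W a = 0) ∧ W e = 0 ∧
      X f = -W f := by
    rcases (show X f = -Y f ∨ X f = Y f by
      revert hXf hYf; generalize X f = x; generalize Y f = y; revert x y; decide) with h | h
    · exact ⟨Y, hY, fun a ha => hYA a (Set.mem_insert_of_mem _ ha), hYe, h⟩
    · exact ⟨-Y, M.neg_mem Y hY, fun a ha => by simp [hYA a (Set.mem_insert_of_mem _ ha)],
        by simp [hYe], by simp [h]⟩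
  obtain ⟨Z, hZ, hZf, hZ'⟩ := M.elim X hX W hW f ⟨hWf, hXf⟩
  have hZe : Z e = X e := by
    have := (hZ' e (by simp [SignVec.sep, hWe])).1
    simpa [SignVec.comp, hXe] using this
  refine hXe (hZe ▸ h1 Z hZ ?_)
  rintro a (rfl | ha)
  · exact hZf
  · have := (hZ' a (by simp [SignVec.sep, hXA a ha])).1
    simpa [SignVec.comp, hXA a ha, hWA a ha] using this

/-- Independence in the underlying matroid. -/
def Indep (M : OrientedMatroid E) (I : Set E) : Prop := ∀ e ∈ I, e ∉ M.cl (I \ {e})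

theorem Indep.subset {M : OrientedMatroid E} {I J : Set E} (hJ : M.Indep J) (h : I ⊆ J) :
    M.Indep I :=
  fun e he hc => hJ e (h he) (M.cl_mono (Set.sdiff_subset_sdiff_left h) hc)

theorem Indep.insert {M : OrientedMatroid E} {J : Set E} (hJ : M.Indep J) {i : E}
    (hi : i ∉ M.cl J) : M.Indep (insert i J) := by
  intro e he hc
  by_cases hei : e = i
  · subst hei
    exact hi (M.cl_mono (by simp) hc)
  · have heJ : e ∈ J := he.resolve_left hei
    have hsub : (Insert.insert i J) \ {e} ⊆ Insert.insert i (J \ {e}) := by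
      rintro x ⟨rfl | hx, hxe⟩
      · exact Set.mem_insert _ _
      · exact Set.mem_insert_of_mem _ ⟨hx, hxe⟩
    have h := M.cl_exchange (M.cl_mono hsub hc) (hJ e heJ)
    rw [Set.insert_sdiff_singleton, Set.insert_eq_of_mem heJ] at h
    exact hi h

theorem Indep.ncard_le [Finite E] {M : OrientedMatroid E} {I : Set E} (n : ℕ) :
    ∀ J : Set E, M.Indep J → J ⊆ M.cl I → (J \ I).ncard = n → J.ncard ≤ I.ncard := by
  induction n with
  | zero =>
    intro J _ _ h
    rw [Set.ncard_eq_zero (Set.toFinite _), Set.sdiff_eq_empty] at h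
    exact Set.ncard_le_ncard h (Set.toFinite _)
  | succ n ih =>
    intro J hJ hJI h
    obtain ⟨j, hjJ, hjI⟩ : (J \ I).Nonempty := by
      rw [← Set.ncard_pos (Set.toFinite _)]; omega
    obtain ⟨i, hiI, hi⟩ : ∃ i ∈ I, i ∉ M.cl (J \ {j}) := by
      by_contra hcon
      push Not at hcon
      exact hJ j hjJ (M.cl_subset_cl hcon (hJI hjJ))
    have hiJ : i ∉ J \ {j} := fun hc => hi (M.subset_cl _ hc)
    have hcard : (Insert.insert i (J \ {j})).ncard = J.ncard := by
      rw [Set.ncard_insert_of_notMem hiJ (Set.toFinite _),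
        Set.ncard_sdiff_singleton_add_one hjJ (Set.toFinite _)]
    rw [← hcard]
    refine ih _ ((hJ.subset Set.sdiff_subset).insert hi) ?_ ?_
    · rintro x (rfl | hx)
      · exact M.subset_cl _ hiI
      · exact hJI hx.1
    · have : (Insert.insert i (J \ {j})) \ I = (J \ I) \ {j} := by
        ext x
        simp only [Set.mem_sdiff, Set.mem_insert_iff, Set.mem_singleton_iff]
        constructor
        · rintro ⟨rfl | hx, hxI⟩
          · exact absurd hiI hxI
          · exact ⟨⟨hx.1, hxI⟩, hx.2⟩
        · rintro ⟨⟨hx, hxI⟩, hxj⟩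
          exact ⟨Or.inr ⟨hx, hxj⟩, hxI⟩
      have hj : j ∈ J \ I := ⟨hjJ, hjI⟩
      rw [this, Set.ncard_sdiff_singleton_of_mem hj, h]
      rfl

/-- The underlying matroid of an oriented matroid. -/
noncomputable def underlying [Finite E] (M : OrientedMatroid E) : Matroid E :=
  (IndepMatroid.ofFinite (E := Set.univ) Set.finite_univ M.Indep
    (fun _ he => absurd he (Set.notMem_empty _))
    (fun _ _ hJ h => hJ.subset h)
    (fun I J hI hJ hlt => by
      obtain ⟨e, heJ, he⟩ : ∃ e ∈ J, e ∉ M.cl I := by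
        by_contra hcon
        push Not at hcon
        exact absurd (Indep.ncard_le _ J hJ hcon rfl) (not_le.mpr hlt)
      exact ⟨e, heJ, fun hI' => he (M.subset_cl _ hI'), hI.insert he⟩)
    (fun _ _ => Set.subset_univ _)).matroid

@[simp] theorem underlying_indep [Finite E] (M : OrientedMatroid E) (I : Set E) :
    M.underlying.Indep I ↔ M.Indep I := Iff.rfl

/-- The rank of an oriented matroid is the rank of its underlying matroid. -/
noncomputable def rank [Finite E] (M : OrientedMatroid E) : ℕ∞ := M.underlying.eRank

/-- An oriented matroid is uniform if its underlying matroid is uniform: the independent sets are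
exactly the sets whose cardinality is at most the rank. -/
def IsUniform [Finite E] (M : OrientedMatroid E) : Prop :=
  ∀ I : Set E, M.underlying.Indep I ↔ I.encard ≤ M.rank

/-- An oriented matroid is acyclic if the all-positive sign vector is a covector. -/
def IsAcyclic (M : OrientedMatroid E) : Prop := (fun _ => 1 : SignVec E) ∈ M.covectors

/-- The cocircuits are the minimal nonzero covectors. -/
def cocircuits (M : OrientedMatroid E) : Set (SignVec E) :=
  {X | X ∈ M.covectors ∧ X ≠ 0 ∧ ∀ Y ∈ M.covectors, Y ≠ 0 → Y.Conf X → Y = X}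

/-- The image of the sign vector `X` on `E` under a bijection `φ : E ≃ F`. -/
def mapSign (φ : E ≃ F) (X : SignVec E) : SignVec F := fun f => X (φ.symm f)

/-- Relabeling equivalence of oriented matroids. -/
def RelabelingEquiv (M : OrientedMatroid E) (N : OrientedMatroid F) : Prop :=
  ∃ φ : E ≃ F, ∀ X : SignVec E, X ∈ M.covectors ↔ mapSign φ X ∈ N.covectors

theorem comp_comm_of_sep_eq_empty {X Y : SignVec E} (h : X.sep Y = ∅) :
    X.comp Y = Y.comp X := by
  funext e
  have he : e ∉ X.sep Y := by simp [h]
  revert he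
  simp only [SignVec.sep, SignVec.comp, Set.mem_ofPred_eq]
  generalize X e = x
  generalize Y e = y
  revert x y
  decide

theorem sep_comm (X Y : SignVec E) : X.sep Y = Y.sep X := by
  ext e
  simp only [SignVec.sep, Set.mem_ofPred_eq]
  generalize X e = x
  generalize Y e = y
  revert x y
  decide

/-- The cocircuit graph `CG(M)`. -/
def cocircuitGraph (M : OrientedMatroid E) : SimpleGraph M.cocircuits where
  Adj X Y := X ≠ Y ∧ SignVec.sep X.1 Y.1 = ∅ ∧
    ∀ Z : M.cocircuits, Z ≠ X → Z ≠ Y → ¬ SignVec.Conf Z.1 (SignVec.comp X.1 Y.1)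
  symm := ⟨fun X Y ⟨h1, h2, h3⟩ => ⟨h1.symm, by rw [sep_comm, h2], fun Z hY hX => by
    rw [← comp_comm_of_sep_eq_empty h2]; exact h3 Z hX hY⟩⟩
  loopless := ⟨fun _ h => h.1 rfl⟩

/-- The vertices of the graph `G(M)`: the cocircuits and two further vertices. -/
inductive GVertex (M : OrientedMatroid E)
  | cocircuit (X : M.cocircuits) : GVertex M
  | vplus : GVertex M
  | vminus : GVertex M

/-- The adjacency relation of `G(M)`. -/
def GAdj (M : OrientedMatroid E) : GVertex M → GVertex M → Prop
  | .cocircuit X, .cocircuit Y => M.cocircuitGraph.Adj X Y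
  | .vplus, .cocircuit X => ∀ e, 0 ≤ X.1 e
  | .cocircuit X, .vplus => ∀ e, 0 ≤ X.1 e
  | .vminus, .cocircuit X => ∀ e, X.1 e ≤ 0
  | .cocircuit X, .vminus => ∀ e, X.1 e ≤ 0
  | _, _ => False

/-- The graph `G(M)`: the cocircuit graph together with a vertex `v₊` joined to all non-negative
cocircuits and a vertex `v₋` joined to all non-positive cocircuits. -/
def G (M : OrientedMatroid E) : SimpleGraph (GVertex M) where
  Adj := M.GAdj
  symm := ⟨fun a b h => by
    cases a <;> cases b <;> first | exact M.cocircuitGraph.adj_symm h | exact h⟩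
  loopless := ⟨fun a h => by
    cases a <;> first | exact M.cocircuitGraph.irrefl h | exact h⟩

end OrientedMatroid

/-!
# The graph `G(M)` determines a uniform oriented matroid

A relabeling equivalence clearly induces an isomorphism of graphs. Conversely, let `M` and `N` be
uniform of ranks `k + 1` and `l + 1`, so that the cocircuits of `M` are the covectors with exactly
`k` zeros and every `k`-set is the zero set of exactly one pair `X, -X` (`IsGeneric` and the lemmas
following it).

*The vertices `v₊` and `v₋`.* Degrees and numbers of common neighbours show that an isomorphism of
`G(M)` with `G(N)` cannot send `v₊` or `v₋` to a cocircuit (`apply_vplus_ne_cocircuit`). Up to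
negation, it therefore restricts to an isomorphism `f` of the cocircuit graphs that respects
non-negative and non-positive cocircuits (`exists_iso_cocircuitGraph`).

*Metric.* The elements where `X` is non-zero and `Y` differs from `X` have to be brought to zero on
any path from `X` to `Y`; if the zero sets of `X` and `Y` differ by one exchange, their number is
the distance (`dist_of_collinear`). With `n` elements, antipodes are at distance `n - k + 1`
(`dist_neg`). Once the antipodal map is known, the metric therefore detects whether the zero set of
`X` loses at most one element on intersection with those of `Y` and `Z`
(`card_sdiff_inter_le_one_iff`), and this ternary relation on `k`-sets determines the ground set
(`IsStarEquiv.exists_equiv`). So an isomorphism that commutes with the antipodal maps is, on zero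
sets, induced by a bijection of the ground sets (`exists_equiv_of_antipodal`).

*Antipodes.* Distances alone do not obviously single out antipodal pairs, so `f` is not known to
commute with the antipodal maps `ν` of `N` and `ν'` of `M`. Put `μ = f ν' f⁻¹`. An involutive
automorphism that commutes with `ν` and moves every cocircuit at least as far as `ν` does permutes
the zero sets through an involution of the ground set, by the previous paragraph. This involution
moves some `l`-set by at most one exchange, which forces the automorphism to agree with `ν` there
and, going along edges, everywhere (`eq_neg_of_involutive`). If antipodes in `M` are at least as far
apart as in `N`, which is no restriction, this applies to all conjugates of `μ` and `ν` that commute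
with `ν`. Hence the dihedral group generated by `μ` and `ν` has a rotation subgroup of odd order,
and a power of `μν` conjugates `ν` to `μ` (`exists_conj_of_involutions`). Composing `f` with the
inverse of this power gives an isomorphism that commutes with the antipodal maps
(`exists_antipodal_of_le`), and that still respects non-negativity since `μν` does
(`exists_antipodal`).

*Signs.* For cocircuits one exchange apart, having opposite signs at `e` is visible in the metric
(`eq_neg_iff`). Starting from non-negative cocircuits, which exist since `M` is acyclic, this shows
that the new isomorphism is a relabeling of cocircuits (`exists_mapSign_eq`), hence of covectors.
-/

/-! ### Cocircuits of a uniform oriented matroid -/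

namespace SignVec

variable {E : Type*}

/-- The zero set of a sign vector on a finite ground set, as a finset. -/
def zeros [Fintype E] (X : SignVec E) : Finset E := Finset.univ.filter fun e => X e = 0

@[simp] theorem mem_zeros [Fintype E] {X : SignVec E} {e : E} : e ∈ X.zeros ↔ X e = 0 := by
  simp [zeros]

@[simp] theorem zeros_neg [Fintype E] (X : SignVec E) : (-X).zeros = X.zeros := by
  ext e; simp

theorem mem_sep {X Y : SignVec E} {e : E} : e ∈ X.sep Y ↔ X e = -Y e ∧ X e ≠ 0 := Iff.rfl

theorem comp_of_ne_zero {X Y : SignVec E} {e : E} (h : X e ≠ 0) : X.comp Y e = X e := by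
  simp [comp, h]

theorem comp_of_eq_zero {X Y : SignVec E} {e : E} (h : X e = 0) : X.comp Y e = Y e := by
  simp [comp, h]

theorem eq_of_notMem_sep {X Y : SignVec E} {e : E} (h : e ∉ X.sep Y) (hX : X e ≠ 0)
    (hY : Y e ≠ 0) : Y e = X e := by
  revert h hX hY
  rw [mem_sep]
  generalize X e = x
  generalize Y e = y
  revert x y
  decide

theorem notMem_sep_of_eq {X Y : SignVec E} {e : E} (h : Y e = X e) : e ∉ X.sep Y := by
  revert h
  rw [mem_sep]
  generalize X e = x
  generalize Y e = y
  revert x y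
  decide

theorem eq_or_eq_neg_of_ne_zero {x y : SignType} (hx : x ≠ 0) (hy : y ≠ 0) : y = x ∨ y = -x := by
  revert x y; decide

theorem ne_neg_self {x : SignType} (hx : x ≠ 0) : x ≠ -x := by
  revert x; decide

theorem neg_ne_zero' {x : SignType} (hx : x ≠ 0) : -x ≠ 0 := by
  revert x; decide

theorem exists_ne_zero {X : SignVec E} (h : X ≠ 0) : ∃ e, X e ≠ 0 := by
  by_contra hcon
  push Not at hcon
  exact h (funext hcon)

theorem Conf.eq_of_ne_zero {X Y : SignVec E} (h : X.Conf Y) {e : E} (he : X e ≠ 0) :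
    X e = Y e :=
  (h e).resolve_right he

theorem Conf.trans {X Y Z : SignVec E} (h : X.Conf Y) (h' : Y.Conf Z) : X.Conf Z := by
  intro e
  rcases h e with h1 | h1
  · rcases h' e with h2 | h2
    · exact Or.inl (h1.trans h2)
    · exact Or.inr (h1.trans h2)
  · exact Or.inr h1

theorem Conf.zeros_subset [Fintype E] {X Y : SignVec E} (h : X.Conf Y) : Y.zeros ⊆ X.zeros := by
  intro e he
  rw [mem_zeros] at he ⊢
  rcases h e with h | h
  · rw [h, he]
  · exact h

theorem Conf.eq_of_zeros_subset [Fintype E] {X Y : SignVec E} (h : X.Conf Y)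
    (hz : X.zeros ⊆ Y.zeros) : X = Y := by
  funext e
  rcases h e with h | h
  · exact h
  · rw [h, mem_zeros.1 (hz (mem_zeros.2 h))]

end SignVec

namespace OrientedMatroid

open SignVec

variable {E : Type*}

/-- Let the covector `W` have its support inside the support of the covector `X`, agree with `X`
at `e`, and vanish somewhere on the support of `X`. Eliminating the separating elements one by one
moves `W` into the closed face of `X` without losing the value at `e`. -/
theorem exists_conf_ne [Finite E] (M : OrientedMatroid E) {X : SignVec E} (hX : X ∈ M.covectors)
    {e : E} (hXe : X e ≠ 0) {W : SignVec E} (hW : W ∈ M.covectors)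
    (hsupp : ∀ f, X f = 0 → W f = 0) (hWe : W e = X e) (hh : ∃ h, X h ≠ 0 ∧ W h = 0) :
    ∃ Y ∈ M.covectors, Y.Conf X ∧ Y e = X e ∧ Y ≠ X := by
  induction hn : (X.sep W).ncard using Nat.strong_induction_on generalizing W with
  | _ n ih =>
    by_cases hS : X.sep W = ∅
    · obtain ⟨h, h1, h2⟩ := hh
      refine ⟨W, hW, fun f => ?_, hWe, fun hc => h1 (hc ▸ h2)⟩
      by_cases hf : W f = 0
      · exact Or.inr hf
      · exact Or.inl (eq_of_notMem_sep (by simp [hS]) (fun h => hf (hsupp f h)) hf)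
    · obtain ⟨f, hf⟩ := Set.nonempty_iff_ne_empty.2 hS
      obtain ⟨Z, hZ, hZf, hZ'⟩ := M.elim X hX W hW f hf
      refine ih _ ?_ hZ ?_ ?_ ⟨f, (mem_sep.1 hf).2, hZf⟩ rfl
      · rw [← hn]
        refine Set.ncard_lt_ncard ⟨fun g hg => ?_, fun hsub => ?_⟩ (Set.toFinite _)
        · by_contra hgW
          have hXg := (mem_sep.1 hg).2
          have := (mem_sep.1 hg).1
          rw [(hZ' g hgW).1, comp_of_ne_zero hXg] at this
          exact ne_neg_self hXg this
        · have := mem_sep.1 (hsub hf)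
          rw [hZf] at this
          exact this.2 (by simpa using this.1)
      · intro g hg
        rw [(hZ' g fun h => (mem_sep.1 h).2 hg).1, comp_of_eq_zero hg, hsupp g hg]
      · rw [(hZ' e (notMem_sep_of_eq hWe)).1, comp_of_ne_zero hXe]

theorem neg_mem_cocircuits {M : OrientedMatroid E} {X : SignVec E}
    (hX : X ∈ M.cocircuits) : -X ∈ M.cocircuits := by
  refine ⟨M.neg_mem X hX.1, fun h0 => hX.2.1 ?_, fun Y hY hY0 hYX => ?_⟩
  · rw [← neg_neg X, h0, neg_zero]
  · rw [← hX.2.2 (-Y) (M.neg_mem Y hY) (fun h0 => hY0 ?_) (fun e => ?_), neg_neg]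
    · rw [← neg_neg Y, h0, neg_zero]
    · rcases hYX e with h1 | h1
      · left; simp [h1]
      · right; simp [h1]

/-- A sign vector is a covector as soon as each of its non-zero entries is realised by a
conformal covector: compose these. -/
theorem mem_covectors_of_conf [Finite E] (M : OrientedMatroid E) {X : SignVec E}
    (h : ∀ e, X e ≠ 0 → ∃ Y ∈ M.covectors, Y.Conf X ∧ Y e = X e) : X ∈ M.covectors := by
  classical
  have := Fintype.ofFinite E
  have key : ∀ s : Finset E, ∃ Y ∈ M.covectors, Y.Conf X ∧ ∀ e ∈ s, Y e = X e := by
    intro s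
    induction s using Finset.induction_on with
    | empty => exact ⟨0, M.zero_mem, fun _ => Or.inr rfl, by simp⟩
    | insert a s _ ih =>
      obtain ⟨Y, hY, hYX, hYs⟩ := ih
      by_cases ha : X a = 0
      · refine ⟨Y, hY, hYX, fun e he => ?_⟩
        rcases Finset.mem_insert.1 he with rfl | he
        · rcases hYX e with h1 | h1
          · exact h1
          · rw [h1, ha]
        · exact hYs e he
      · obtain ⟨W, hW, hWX, hWa⟩ := h a ha
        refine ⟨Y.comp W, M.comp_mem Y hY W hW, fun e => ?_, fun e he => ?_⟩
        · by_cases hYe : Y e = 0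
          · rw [comp_of_eq_zero hYe]; exact hWX e
          · rw [comp_of_ne_zero hYe]; exact hYX e
        · by_cases hYe : Y e = 0
          · rw [comp_of_eq_zero hYe]
            rcases Finset.mem_insert.1 he with rfl | he
            · exact hWa
            · rw [← hYs e he, hYe]
              rcases hWX e with h1 | h1
              · rw [h1, ← hYs e he, hYe]
              · exact h1
          · rw [comp_of_ne_zero hYe]; exact hYX.eq_of_ne_zero hYe
  obtain ⟨Y, hY, _, hYX⟩ := key Finset.univ
  rwa [show X = Y from funext fun e => (hYX e (Finset.mem_univ e)).symm]

/-- The combinatorial content of being uniform of rank `k + 1`, in terms of covectors: non-zero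
covectors have at most `k` zeros, and a set of at most `k` elements is closed. -/
structure IsGeneric [Fintype E] (M : OrientedMatroid E) (k : ℕ) : Prop where
  lt_card : k < Fintype.card E
  card_zeros_le : ∀ X ∈ M.covectors, X ≠ 0 → X.zeros.card ≤ k
  exists_covector : ∀ A : Finset E, A.card ≤ k → ∀ e ∉ A,
    ∃ X ∈ M.covectors, (∀ a ∈ A, X a = 0) ∧ X e ≠ 0

theorem IsUniform.isGeneric [Fintype E] [DecidableEq E] {M : OrientedMatroid E}
    (hM : M.IsUniform) {k : ℕ} (hk : M.rank = (k + 1 : ℕ)) : M.IsGeneric k := by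
  have key : ∀ A : Finset E, M.Indep (A : Set E) ↔ A.card ≤ k + 1 := by
    intro A
    rw [← underlying_indep, hM, hk, Set.encard_coe_eq_coe_finsetCard, Nat.cast_le]
  refine ⟨?_, ?_, ?_⟩
  · obtain ⟨B, hB⟩ := M.underlying.exists_isBase
    have h1 : B.encard = (k + 1 : ℕ) := by rw [hB.encard_eq_eRank]; exact hk
    have h2 : B.encard ≤ (Fintype.card E : ℕ∞) := by
      have := Set.encard_le_encard (Set.subset_univ B)
      rwa [← Finset.coe_univ, Set.encard_coe_eq_coe_finsetCard, Finset.card_univ] at this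
    rw [h1, Nat.cast_le] at h2
    omega
  · intro X hX hX0
    obtain ⟨e, he⟩ := exists_ne_zero hX0
    by_contra hcon
    obtain ⟨A, hAX, hA⟩ := Finset.exists_subset_card_eq (show k + 1 ≤ X.zeros.card by omega)
    have heA : e ∉ A := fun h => he (mem_zeros.1 (hAX h))
    have hcl : e ∉ M.cl (A : Set E) := fun h => he (h X hX fun a ha => mem_zeros.1 (hAX ha))
    have := ((key A).2 hA.le).insert hcl
    rw [← Finset.coe_insert, key, Finset.card_insert_of_notMem heA] at this
    omega
  · intro A hA e he
    have h1 : M.Indep ((insert e A : Finset E) : Set E) := by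
      rw [key, Finset.card_insert_of_notMem he]; omega
    have h2 := h1 e (by simp)
    have h3 : ((insert e A : Finset E) : Set E) \ {e} = (A : Set E) := by
      rw [Finset.coe_insert, Set.insert_sdiff_of_mem _ (Set.mem_singleton e),
        Set.sdiff_singleton_eq_self (by simpa using he)]
    rw [h3] at h2
    simp only [cl, Set.mem_ofPred_eq, not_forall] at h2
    obtain ⟨X, hX, hXA, hXe⟩ := h2
    exact ⟨X, hX, fun a ha => hXA a ha, hXe⟩

section Generic

variable [Fintype E] {M : OrientedMatroid E} {k : ℕ}

theorem IsGeneric.ne_zero_of_card (h : M.IsGeneric k) {X : SignVec E} (hc : X.zeros.card = k) :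
    X ≠ 0 := by
  rintro rfl
  have : (0 : SignVec E).zeros = Finset.univ := by ext; simp
  rw [this, Finset.card_univ] at hc
  exact h.lt_card.ne' hc

/-- A set of size `k` is the zero set of at most one pair of opposite covectors. -/
theorem IsGeneric.eq_or_eq_neg (h : M.IsGeneric k) {X Y : SignVec E} (hX : X ∈ M.covectors)
    (hY : Y ∈ M.covectors) (hc : X.zeros.card = k) (hz : X.zeros = Y.zeros) :
    Y = X ∨ Y = -X := by
  classical
  by_contra hcon
  push Not at hcon
  have hzero : ∀ f, X f = 0 ↔ Y f = 0 := fun f => by rw [← mem_zeros, hz, mem_zeros]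
  obtain ⟨e, he⟩ := Function.ne_iff.1 hcon.1
  obtain ⟨f, hf⟩ := Function.ne_iff.1 hcon.2
  have hXe : X e ≠ 0 := fun h0 => he (by rw [h0, (hzero e).1 h0])
  have hXf : X f ≠ 0 := fun h0 => hf (by rw [Pi.neg_apply, h0, (hzero f).1 h0]; rfl)
  have heS : e ∈ X.sep Y := by
    by_contra hc
    exact he (eq_of_notMem_sep hc hXe (mt (hzero e).2 hXe))
  have hfS : f ∉ X.sep Y := fun hc => hf (by rw [Pi.neg_apply, (mem_sep.1 hc).1, neg_neg])
  obtain ⟨Z, hZ, hZe, hZ'⟩ := M.elim X hX Y hY e heS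
  have hZ0 : Z ≠ 0 := fun h0 => by
    have := (hZ' f hfS).1
    rw [comp_of_ne_zero hXf, h0] at this
    exact hXf this.symm
  have hsub : insert e X.zeros ⊆ Z.zeros := by
    intro g hg
    rcases Finset.mem_insert.1 hg with rfl | hg
    · simpa using hZe
    · have hg' := mem_zeros.1 hg
      rw [mem_zeros, (hZ' g fun hc => (mem_sep.1 hc).2 hg').1, comp_of_eq_zero hg',
        (hzero g).1 hg']
  have := (Finset.card_le_card hsub).trans (h.card_zeros_le Z hZ hZ0)
  rw [Finset.card_insert_of_notMem (by simpa using hXe)] at this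
  omega

theorem IsGeneric.mem_cocircuits_of_card (h : M.IsGeneric k) {X : SignVec E}
    (hX : X ∈ M.covectors) (hc : X.zeros.card = k) : X ∈ M.cocircuits := by
  refine ⟨hX, h.ne_zero_of_card hc, fun Y hY hY0 hYX => ?_⟩
  have h1 := hYX.zeros_subset
  have h2 := Finset.eq_of_subset_of_card_le h1 (hc ▸ h.card_zeros_le Y hY hY0)
  exact hYX.eq_of_zeros_subset h2.ge

/-- Inside a face of dimension at least one there is a smaller face with a prescribed
non-zero entry. -/
theorem IsGeneric.exists_smaller (h : M.IsGeneric k) {X : SignVec E} (hX : X ∈ M.covectors)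
    (hc : X.zeros.card < k) {e : E} (he : X e ≠ 0) :
    ∃ Y ∈ M.covectors, Y.Conf X ∧ Y e = X e ∧ Y ≠ X := by
  classical
  have heZ : e ∉ X.zeros := by simpa using he
  obtain ⟨a, ha⟩ : ∃ a, a ∉ insert e X.zeros := by
    by_contra hcon
    push Not at hcon
    have h1 := Finset.eq_univ_iff_forall.2 hcon
    have h2 := Finset.card_insert_of_notMem heZ
    rw [h1, Finset.card_univ] at h2
    have := h.lt_card
    omega
  rw [Finset.mem_insert, not_or] at ha
  obtain ⟨W, hW, hWA, hWe⟩ := h.exists_covector (insert a X.zeros)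
    (by rw [Finset.card_insert_of_notMem ha.2]; omega) e
    (by rw [Finset.mem_insert, not_or]; exact ⟨fun h => ha.1 h.symm, heZ⟩)
  have hWz : ∀ f, X f = 0 → W f = 0 := fun f hf =>
    hWA f (Finset.mem_insert_of_mem (mem_zeros.2 hf))
  have hWa : W a = 0 := hWA a (Finset.mem_insert_self _ _)
  have hXa : X a ≠ 0 := by simpa using ha.2
  rcases eq_or_eq_neg_of_ne_zero he hWe with h1 | h1
  · exact M.exists_conf_ne hX he hW hWz h1 ⟨a, hXa, hWa⟩
  · refine M.exists_conf_ne hX he (M.neg_mem W hW) (fun f hf => ?_) ?_ ⟨a, hXa, ?_⟩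
    · simp [hWz f hf]
    · simp [h1]
    · simp [hWa]

theorem IsGeneric.mem_cocircuits_iff (h : M.IsGeneric k) {X : SignVec E} :
    X ∈ M.cocircuits ↔ X ∈ M.covectors ∧ X.zeros.card = k := by
  refine ⟨fun hX => ⟨hX.1, ?_⟩, fun hX => h.mem_cocircuits_of_card hX.1 hX.2⟩
  by_contra hne
  have hlt : X.zeros.card < k := lt_of_le_of_ne (h.card_zeros_le X hX.1 hX.2.1) hne
  obtain ⟨e, he⟩ := exists_ne_zero hX.2.1
  obtain ⟨Y, hY, hYX, hYe, hne⟩ := h.exists_smaller hX.1 hlt he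
  exact hne (hX.2.2 Y hY (fun h0 => he (by rw [← hYe, h0]; rfl)) hYX)

/-- Every covector is the conformal composition of cocircuits. -/
theorem IsGeneric.exists_cocircuit_conf (h : M.IsGeneric k) {X : SignVec E}
    (hX : X ∈ M.covectors) {e : E} (he : X e ≠ 0) :
    ∃ Y ∈ M.cocircuits, Y.Conf X ∧ Y e = X e := by
  induction hn : k - X.zeros.card using Nat.strong_induction_on generalizing X with
  | _ n ih =>
    have hX0 : X ≠ 0 := fun h0 => he (by rw [h0]; rfl)
    rcases (h.card_zeros_le X hX hX0).lt_or_eq with hlt | heq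
    · obtain ⟨Y, hY, hYX, hYe, hne⟩ := h.exists_smaller hX hlt he
      have hss : X.zeros ⊂ Y.zeros :=
        ⟨hYX.zeros_subset, fun hs => hne (hYX.eq_of_zeros_subset hs)⟩
      have := Finset.card_lt_card hss
      obtain ⟨Z, hZ, hZY, hZe⟩ := ih (k - Y.zeros.card) (by omega) hY (hYe ▸ he) rfl
      exact ⟨Z, hZ, hZY.trans hYX, hZe.trans hYe⟩
    · exact ⟨X, h.mem_cocircuits_of_card hX heq, fun _ => Or.inl rfl, rfl⟩

end Generic

end OrientedMatroid

/-! ### Lines, adjacency and distances in the cocircuit graph -/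

namespace SignVec

variable {E : Type*} [Fintype E]

/-- The elements at which `X` is non-zero and `Y` differs from `X`: those that a path of cocircuits
from `X` to `Y` has to bring to zero at some point after its start. -/
def moved (X Y : SignVec E) : Finset E := Finset.univ.filter fun e => X e ≠ 0 ∧ Y e ≠ X e

theorem mem_moved {X Y : SignVec E} {e : E} : e ∈ X.moved Y ↔ X e ≠ 0 ∧ Y e ≠ X e := by
  simp [moved]

theorem moved_self (X : SignVec E) : X.moved X = ∅ := by
  ext; simp [mem_moved]

theorem moved_subset [DecidableEq E] (X Y Z : SignVec E) :
    X.moved Z ⊆ X.moved Y ∪ Y.moved Z := by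
  intro e
  simp only [Finset.mem_union, mem_moved]
  generalize X e = x
  generalize Y e = y
  generalize Z e = z
  revert x y z
  decide

theorem moved_eq_of_sep_eq_empty [DecidableEq E] {X Y : SignVec E} (h : X.sep Y = ∅) :
    X.moved Y = Y.zeros \ X.zeros := by
  ext e
  have he : e ∉ X.sep Y := by simp [h]
  revert he
  rw [mem_sep, mem_moved, Finset.mem_sdiff, mem_zeros, mem_zeros]
  generalize X e = x
  generalize Y e = y
  revert x y
  decide

theorem card_moved_add_card_moved_neg [DecidableEq E] (X Y : SignVec E) :
    (X.moved Y).card + (Y.moved (-X)).card + (X.zeros ∩ Y.zeros).card = Fintype.card E := by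
  have h1 : Disjoint (X.moved Y) (Y.moved (-X)) := by
    rw [Finset.disjoint_left]
    intro e
    rw [mem_moved, mem_moved, Pi.neg_apply]
    generalize X e = x
    generalize Y e = y
    revert x y
    decide
  have h2 : X.moved Y ∪ Y.moved (-X) = (X.zeros ∩ Y.zeros)ᶜ := by
    ext e
    rw [Finset.mem_union, mem_moved, mem_moved, Pi.neg_apply, Finset.mem_compl, Finset.mem_inter,
      mem_zeros, mem_zeros]
    generalize X e = x
    generalize Y e = y
    revert x y
    decide
  rw [← Finset.card_union_of_disjoint h1, h2, Finset.card_compl_add_card]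

end SignVec

namespace OrientedMatroid

open SignVec

variable {E : Type*} {M : OrientedMatroid E}

instance : InvolutiveNeg M.cocircuits where
  neg X := ⟨-X.1, neg_mem_cocircuits X.2⟩
  neg_neg X := Subtype.ext (neg_neg X.1)

@[simp] theorem coe_neg_cocircuit (X : M.cocircuits) : (-X).1 = -X.1 := rfl

theorem cocircuit_ne_neg (X : M.cocircuits) : X ≠ -X := by
  intro h
  obtain ⟨e, he⟩ := exists_ne_zero X.2.2.1
  exact ne_neg_self he (congrFun (congrArg Subtype.val h) e)

theorem sdiff_eq_singleton_of_erase_subset [DecidableEq E] {A B : Finset E} {e : E}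
    (he : e ∈ A) (he' : e ∉ B) (h : A.erase e ⊆ B) : A \ B = {e} := by
  ext f
  rw [Finset.mem_sdiff, Finset.mem_singleton]
  refine ⟨fun hf => ?_, fun hf => by rw [hf]; exact ⟨he, he'⟩⟩
  by_contra hne
  exact hf.2 (h (Finset.mem_erase.2 ⟨hne, hf.1⟩))

theorem erase_subset_of_sdiff_eq_singleton [DecidableEq E] {A B : Finset E} {e : E}
    (h : A \ B = {e}) :
    A.erase e ⊆ B := by
  intro f hf
  rw [Finset.mem_erase] at hf
  by_contra hB
  have : f ∈ A \ B := Finset.mem_sdiff.2 ⟨hf.2, hB⟩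
  rw [h, Finset.mem_singleton] at this
  exact hf.1 this

theorem exists_notMem_zeros [Fintype E] (X : M.cocircuits) : ∃ e, e ∉ X.1.zeros := by
  obtain ⟨e, he⟩ := exists_ne_zero X.2.2.1
  exact ⟨e, by simpa using he⟩

namespace IsGeneric

variable [Fintype E] {k : ℕ}

theorem card_zeros (h : M.IsGeneric k) (X : M.cocircuits) : X.1.zeros.card = k :=
  (h.mem_cocircuits_iff.1 X.2).2

theorem cocircuit_eq_or_eq_neg (h : M.IsGeneric k) {X Y : M.cocircuits}
    (hz : X.1.zeros = Y.1.zeros) : Y = X ∨ Y = -X := by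
  rcases h.eq_or_eq_neg X.2.1 Y.2.1 (h.card_zeros X) hz with h1 | h1
  · exact Or.inl (Subtype.ext h1)
  · exact Or.inr (Subtype.ext h1)

/-- Every `k`-set is the zero set of a cocircuit, with prescribed sign at one further element. -/
theorem exists_cocircuit_zeros (h : M.IsGeneric k) {A : Finset E} (hA : A.card = k) {e : E}
    (he : e ∉ A) {s : SignType} (hs : s ≠ 0) :
    ∃ X : M.cocircuits, X.1.zeros = A ∧ X.1 e = s := by
  obtain ⟨X, hX, hXA, hXe⟩ := h.exists_covector A hA.le e he
  have hX0 : X ≠ 0 := fun h0 => hXe (by rw [h0]; rfl)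
  have hz : X.zeros = A := by
    refine (Finset.eq_of_subset_of_card_le (fun a ha => mem_zeros.2 (hXA a ha)) ?_).symm
    rw [hA]
    exact h.card_zeros_le X hX hX0
  have hXc := h.mem_cocircuits_of_card hX (hz ▸ hA)
  rcases eq_or_eq_neg_of_ne_zero hXe hs with h1 | h1
  · exact ⟨⟨X, hXc⟩, hz, h1.symm⟩
  · exact ⟨-⟨X, hXc⟩, by simpa using hz, by simp [h1]⟩

theorem exists_cocircuit_zeros' (h : M.IsGeneric k) {A : Finset E} (hA : A.card = k) :
    ∃ X : M.cocircuits, X.1.zeros = A := by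
  obtain ⟨e, he⟩ : ∃ e, e ∉ A := by
    by_contra hcon
    push Not at hcon
    rw [Finset.eq_univ_iff_forall.2 hcon, Finset.card_univ] at hA
    exact h.lt_card.ne' hA
  obtain ⟨X, hX, _⟩ := h.exists_cocircuit_zeros hA he (one_ne_zero (α := SignType))
  exact ⟨X, hX⟩

theorem zeros_eq_iff (h : M.IsGeneric k) {X Y : M.cocircuits} :
    X.1.zeros = Y.1.zeros ↔ Y = X ∨ Y = -X := by
  refine ⟨h.cocircuit_eq_or_eq_neg, ?_⟩
  rintro (rfl | rfl)
  · rfl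
  · rw [coe_neg_cocircuit, zeros_neg]

theorem zeros_eq_of_subset (h : M.IsGeneric k) {X Y : M.cocircuits}
    (hs : X.1.zeros ⊆ Y.1.zeros) : X.1.zeros = Y.1.zeros :=
  Finset.eq_of_subset_of_card_le hs (by rw [h.card_zeros, h.card_zeros])

variable [DecidableEq E]

theorem card_sdiff_comm (h : M.IsGeneric k) (X Y : M.cocircuits) :
    (X.1.zeros \ Y.1.zeros).card = (Y.1.zeros \ X.1.zeros).card :=
  Finset.card_sdiff_comm ((h.card_zeros X).trans (h.card_zeros Y).symm)

/-- Elimination on the line spanned by two cocircuits whose zero sets differ by one exchange: the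
cocircuit of the line that vanishes at a separating element `f` lies between the two. -/
theorem exists_between (h : M.IsGeneric k) {X Y : M.cocircuits}
    (hXY : (X.1.zeros \ Y.1.zeros).card = 1) {f : E} (hf : f ∈ X.1.sep Y.1) :
    ∃ W : M.cocircuits, W.1.zeros = insert f (X.1.zeros ∩ Y.1.zeros) ∧
      ∀ g ∉ X.1.sep Y.1, W.1 g = X.1.comp Y.1 g ∧ W.1 g = Y.1.comp X.1 g := by
  obtain ⟨Z, hZ, hZf, hZ'⟩ := M.elim X.1 X.2.1 Y.1 Y.2.1 f hf
  have hcard : (insert f (X.1.zeros ∩ Y.1.zeros)).card = k := by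
    have h1 := Finset.card_sdiff_add_card_inter X.1.zeros Y.1.zeros
    rw [hXY, h.card_zeros] at h1
    rw [Finset.card_insert_of_notMem, add_comm, h1]
    simp only [Finset.mem_inter, mem_zeros, not_and_or]
    exact Or.inl (mem_sep.1 hf).2
  have hsub : insert f (X.1.zeros ∩ Y.1.zeros) ⊆ Z.zeros := by
    intro g hg
    rcases Finset.mem_insert.1 hg with rfl | hg
    · simpa using hZf
    · rw [Finset.mem_inter, mem_zeros, mem_zeros] at hg
      rw [mem_zeros, (hZ' g fun hc => (mem_sep.1 hc).2 hg.1).1, comp_of_eq_zero hg.1, hg.2]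
  have hZ0 : Z ≠ 0 := by
    obtain ⟨g, hg⟩ := Finset.card_eq_one.1 ((h.card_sdiff_comm Y X).trans hXY)
    have hg' : g ∈ Y.1.zeros \ X.1.zeros := by simp [hg]
    simp only [Finset.mem_sdiff, mem_zeros] at hg'
    intro h0
    have := (hZ' g fun hc => (mem_sep.1 hc).2 (by
      rw [(mem_sep.1 hc).1, hg'.1]; rfl)).1
    rw [comp_of_ne_zero hg'.2, h0] at this
    exact hg'.2 this.symm
  have hz := Finset.eq_of_subset_of_card_le hsub
    (by rw [hcard]; exact h.card_zeros_le Z hZ hZ0)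
  exact ⟨⟨Z, h.mem_cocircuits_of_card hZ (hz ▸ hcard)⟩, hz.symm, hZ'⟩

/-- The cocircuit found by `exists_between` splits the elements to be moved from `X` to `Y`. -/
theorem exists_between_card (h : M.IsGeneric k) {X Y : M.cocircuits}
    (hXY : (X.1.zeros \ Y.1.zeros).card = 1) {f : E} (hf : f ∈ X.1.sep Y.1) :
    ∃ W : M.cocircuits, W.1.zeros = insert f (X.1.zeros ∩ Y.1.zeros) ∧
      (X.1.zeros \ W.1.zeros).card = 1 ∧ (W.1.zeros \ Y.1.zeros).card = 1 ∧
      (X.1.moved W.1).card + (W.1.moved Y.1).card = (X.1.moved Y.1).card := by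
  obtain ⟨W, hW, hW'⟩ := h.exists_between hXY hf
  have hf' := mem_sep.1 hf
  have hYf : Y.1 f ≠ 0 := fun h0 => hf'.2 (by rw [hf'.1, h0]; rfl)
  have h1 : (X.1.zeros \ W.1.zeros).card = 1 := by
    rw [← hXY]
    congr 1
    ext g
    simp only [Finset.mem_sdiff, hW, Finset.mem_insert, Finset.mem_inter, mem_zeros]
    constructor
    · rintro ⟨h1, h2⟩; exact ⟨h1, fun h3 => h2 (Or.inr ⟨h1, h3⟩)⟩
    · rintro ⟨h1, h2⟩
      refine ⟨h1, ?_⟩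
      rintro (rfl | h3)
      · exact hf'.2 h1
      · exact h2 h3.2
  refine ⟨W, hW, h1, ?_, ?_⟩
  · rw [Finset.card_eq_one]
    refine ⟨f, ?_⟩
    ext g
    simp only [Finset.mem_sdiff, hW, Finset.mem_insert, Finset.mem_inter, mem_zeros,
      Finset.mem_singleton]
    constructor
    · rintro ⟨h1 | h1, h2⟩
      · exact h1
      · exact absurd h1.2 h2
    · rintro rfl; exact ⟨Or.inl rfl, hYf⟩
  · have key : ∀ g, (g ∈ X.1.moved Y.1 ↔ g ∈ X.1.moved W.1 ∨ g ∈ W.1.moved Y.1) ∧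
        ¬ (g ∈ X.1.moved W.1 ∧ g ∈ W.1.moved Y.1) := by
      intro g
      have hWg : W.1 g = 0 ↔ g = f ∨ (X.1 g = 0 ∧ Y.1 g = 0) := by
        rw [← mem_zeros, hW, Finset.mem_insert, Finset.mem_inter, mem_zeros, mem_zeros]
      rw [mem_moved, mem_moved, mem_moved]
      by_cases hg : g ∈ X.1.sep Y.1
      · have hg' := mem_sep.1 hg
        by_cases hgf : g = f
        · have h0 := hWg.2 (Or.inl hgf)
          rw [h0]
          revert hg'
          generalize X.1 g = x
          generalize Y.1 g = y
          revert x y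
          decide
        · have h0 : W.1 g ≠ 0 := by
            rw [Ne, hWg]; rintro (h1 | h1)
            · exact hgf h1
            · exact hg'.2 h1.1
          revert h0 hg'
          generalize X.1 g = x
          generalize Y.1 g = y
          generalize W.1 g = w
          revert x y w
          decide
      · have h0 := (hW' g hg).1
        by_cases hXg : X.1 g = 0
        · rw [comp_of_eq_zero hXg] at h0
          simp [h0, hXg]
        · rw [comp_of_ne_zero hXg] at h0
          simp [h0, hXg]
    rw [← Finset.card_union_of_disjoint]
    · congr 1
      ext g
      rw [Finset.mem_union, (key g).1]
    · rw [Finset.disjoint_left]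
      exact fun g h1 h2 => (key g).2 ⟨h1, h2⟩

/-- A cocircuit conformal to `X ∘ Y` would lie on the line through `X` and `Y`, and none of the
cocircuits of this line other than `X` and `Y` has the right signs. -/
theorem adj_of_sep_eq_empty (h : M.IsGeneric k) {X Y : M.cocircuits}
    (hXY : (X.1.zeros \ Y.1.zeros).card = 1) (hS : X.1.sep Y.1 = ∅) :
    M.cocircuitGraph.Adj X Y := by
  obtain ⟨e, he⟩ := Finset.card_eq_one.1 hXY
  obtain ⟨g, hg⟩ := Finset.card_eq_one.1 ((h.card_sdiff_comm Y X).trans hXY)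
  have he' : e ∈ X.1.zeros \ Y.1.zeros := by simp [he]
  have hg' : g ∈ Y.1.zeros \ X.1.zeros := by simp [hg]
  simp only [Finset.mem_sdiff, mem_zeros] at he' hg'
  refine ⟨fun hc => he'.2 (hc ▸ he'.1), hS, fun Z hZX hZY hZ => ?_⟩
  have hZe : Z.1 e ≠ 0 → Z.1 e = Y.1 e := fun h0 => by
    rw [hZ.eq_of_ne_zero h0, comp_of_eq_zero he'.1]
  have hZg : Z.1 g ≠ 0 → Z.1 g = X.1 g := fun h0 => by
    rw [hZ.eq_of_ne_zero h0, comp_of_ne_zero hg'.2]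
  have hBZ : X.1.zeros ∩ Y.1.zeros ⊆ Z.1.zeros := by
    intro f hf
    rw [Finset.mem_inter, mem_zeros, mem_zeros] at hf
    refine hZ.zeros_subset (mem_zeros.2 ?_)
    rw [comp_of_eq_zero hf.1, hf.2]
  have hBcard : (X.1.zeros ∩ Y.1.zeros).card + 1 = k := by
    have := Finset.card_sdiff_add_card_inter X.1.zeros Y.1.zeros
    rw [hXY, h.card_zeros] at this
    omega
  obtain ⟨f, hfZ, hfB⟩ := Finset.exists_mem_notMem_of_card_lt_card
    (s := X.1.zeros ∩ Y.1.zeros) (t := Z.1.zeros) (by rw [h.card_zeros]; omega)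
  have hZz : Z.1.zeros = insert f (X.1.zeros ∩ Y.1.zeros) := by
    refine (Finset.eq_of_subset_of_card_le (Finset.insert_subset hfZ hBZ) ?_).symm
    rw [h.card_zeros, Finset.card_insert_of_notMem hfB, hBcard]
  rw [Finset.mem_inter, mem_zeros, mem_zeros] at hfB
  by_cases hXf : X.1 f = 0
  · have hz : X.1.zeros = Z.1.zeros := by
      refine (Finset.eq_of_subset_of_card_le ?_ ?_).symm
      · rw [hZz]
        exact Finset.insert_subset (mem_zeros.2 hXf) Finset.inter_subset_left
      · rw [h.card_zeros, h.card_zeros]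
    rcases h.cocircuit_eq_or_eq_neg hz with h1 | h1
    · exact hZX h1
    · have hv : Z.1 g = -X.1 g := by rw [h1]; rfl
      have := hZg (by rw [hv]; exact neg_ne_zero' hg'.2)
      exact ne_neg_self hg'.2 (this.symm.trans hv)
  by_cases hYf : Y.1 f = 0
  · have hz : Y.1.zeros = Z.1.zeros := by
      refine (Finset.eq_of_subset_of_card_le ?_ ?_).symm
      · rw [hZz]
        exact Finset.insert_subset (mem_zeros.2 hYf) Finset.inter_subset_right
      · rw [h.card_zeros, h.card_zeros]
    rcases h.cocircuit_eq_or_eq_neg hz with h1 | h1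
    · exact hZY h1
    · have hv : Z.1 e = -Y.1 e := by rw [h1]; rfl
      have := hZe (by rw [hv]; exact neg_ne_zero' he'.2)
      exact ne_neg_self he'.2 (this.symm.trans hv)
  -- the cocircuit `W` with the zero set of `Z` that lies between `X` and `-Y` has the sign of `-Y`
  -- at `e` and that of `X` at `g`, so neither `W` nor `-W` can be `Z`
  have hYX : Y.1 f = X.1 f := eq_of_notMem_sep (by simp [hS]) hXf hYf
  obtain ⟨W, hW, hW'⟩ := h.exists_between (X := X) (Y := -Y) (f := f) (by simpa using hXY)
    (mem_sep.2 ⟨by simp [hYX], hXf⟩)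
  have hWe : W.1 e = -Y.1 e := by
    rw [(hW' e fun hc => (mem_sep.1 hc).2 he'.1).1, comp_of_eq_zero he'.1]; rfl
  have hWg : W.1 g = X.1 g := by
    have h0 : g ∉ X.1.sep (-Y).1 := fun hc => hg'.2 (by
      have := (mem_sep.1 hc).1
      rw [this]; simp [hg'.1])
    rw [(hW' g h0).1, comp_of_ne_zero hg'.2]
  have hz : Z.1.zeros = W.1.zeros := by rw [hZz, hW]; simp
  rcases h.cocircuit_eq_or_eq_neg hz with h1 | h1
  · rw [h1] at hWe
    have := hZe (by rw [hWe]; exact neg_ne_zero' he'.2)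
    exact ne_neg_self he'.2 (this.symm.trans hWe)
  · have hv : Z.1 g = -X.1 g := by rw [← hWg, h1]; simp
    have := hZg (by rw [hv]; exact neg_ne_zero' hg'.2)
    exact ne_neg_self hg'.2 (this.symm.trans hv)

/-- On each line through `X` there is a neighbour of `X` on either side. -/
theorem exists_neighbor (h : M.IsGeneric k) (X : M.cocircuits) {e : E} (he : e ∈ X.1.zeros)
    {s : SignType} (hs : s ≠ 0) :
    ∃ Y : M.cocircuits, X.1.zeros \ Y.1.zeros = {e} ∧ Y.1 e = s ∧ X.1.sep Y.1 = ∅ := by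
  set S : Set M.cocircuits := {Y | X.1.zeros.erase e ⊆ Y.1.zeros ∧ Y.1 e = s} with hSdef
  have hcol : ∀ Y ∈ S, X.1.zeros \ Y.1.zeros = {e} := fun Y hY =>
    sdiff_eq_singleton_of_erase_subset he (by rw [mem_zeros, hY.2]; exact hs) hY.1
  have hne : S.Nonempty := by
    obtain ⟨g, hg⟩ := exists_notMem_zeros X
    have hcard : (insert g (X.1.zeros.erase e)).card = k := by
      rw [Finset.card_insert_of_notMem fun hc => hg (Finset.mem_of_mem_erase hc),
        Finset.card_erase_add_one he, h.card_zeros]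
    obtain ⟨Y, hY, hYe⟩ := h.exists_cocircuit_zeros hcard (e := e) (by
      rw [Finset.mem_insert, not_or]
      exact ⟨fun hc => hg (hc ▸ he), Finset.notMem_erase _ _⟩) hs
    exact ⟨Y, hY ▸ Finset.subset_insert _ _, hYe⟩
  obtain ⟨Y, hY, hmin⟩ :=
    Set.exists_min_image S (fun Y => (X.1.sep Y.1).ncard) (Set.toFinite S) hne
  refine ⟨Y, hcol Y hY, hY.2, ?_⟩
  by_contra hcon
  obtain ⟨f, hf⟩ := Set.nonempty_iff_ne_empty.2 hcon
  obtain ⟨W, hW, hW'⟩ := h.exists_between (by rw [hcol Y hY]; simp) hf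
  have hWS : W ∈ S := by
    refine ⟨fun g hg => ?_, ?_⟩
    · rw [hW]
      exact Finset.mem_insert_of_mem (Finset.mem_inter.2 ⟨Finset.mem_of_mem_erase hg, hY.1 hg⟩)
    · have he0 := mem_zeros.1 he
      rw [(hW' e fun hc => (mem_sep.1 hc).2 he0).1, comp_of_eq_zero he0, hY.2]
  refine absurd (hmin W hWS) (not_le.2 (Set.ncard_lt_ncard ⟨fun g hg => ?_, fun hsub => ?_⟩
    (Set.toFinite _)))
  · by_contra hgY
    have hXg := (mem_sep.1 hg).2
    have := (mem_sep.1 hg).1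
    rw [(hW' g hgY).1, comp_of_ne_zero hXg] at this
    exact ne_neg_self hXg this
  · have h1 := mem_sep.1 (hsub hf)
    have h2 : W.1 f = 0 := by rw [← mem_zeros, hW]; simp
    rw [h2] at h1
    exact h1.2 (by simpa using h1.1)

end IsGeneric

/-- A cocircuit `Z` next to `X` that leaves the zero set of `X` only at `e`, with the sign of `Y`
there, obstructs adjacency of `X` to any `Y` other than `Z`. -/
theorem conf_comp_of_erase_subset [Fintype E] [DecidableEq E] {X Y Z : SignVec E} {e : E}
    (hS : X.sep Z = ∅) (hz : X.zeros \ Z.zeros = {e}) (hZe : Z e = Y e) :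
    Z.Conf (X.comp Y) := by
  intro g
  by_cases hZg : Z g = 0
  · exact Or.inr hZg
  · left
    by_cases hXg : X g = 0
    · have : g ∈ X.zeros \ Z.zeros := by simp [hXg, hZg]
      rw [hz, Finset.mem_singleton] at this
      rw [comp_of_eq_zero hXg, this, hZe]
    · rw [comp_of_ne_zero hXg]
      exact eq_of_notMem_sep (by simp [hS]) hXg hZg

namespace IsGeneric

variable [Fintype E] [DecidableEq E] {k : ℕ}

/-- Adjacent cocircuits are those one exchange apart without separating elements. -/
theorem adj_iff (h : M.IsGeneric k) {X Y : M.cocircuits} :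
    M.cocircuitGraph.Adj X Y ↔ (X.1.zeros \ Y.1.zeros).card = 1 ∧ X.1.sep Y.1 = ∅ := by
  refine ⟨fun hadj => ⟨?_, hadj.2.1⟩, fun hXY => h.adj_of_sep_eq_empty hXY.1 hXY.2⟩
  obtain ⟨hne, hS, hmin⟩ := hadj
  obtain ⟨e, he⟩ : (X.1.zeros \ Y.1.zeros).Nonempty := by
    rw [Finset.nonempty_iff_ne_empty, Ne, Finset.sdiff_eq_empty_iff_subset]
    intro hsub
    rcases h.cocircuit_eq_or_eq_neg (h.zeros_eq_of_subset hsub) with h1 | h1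
    · exact hne h1.symm
    · obtain ⟨f, hf⟩ := exists_ne_zero X.2.2.1
      have : f ∈ X.1.sep Y.1 := by
        rw [h1]; exact mem_sep.2 ⟨by simp, hf⟩
      simp [hS] at this
  have he' := he
  simp only [Finset.mem_sdiff, mem_zeros] at he'
  obtain ⟨Z, hZ, hZe, hZS⟩ := h.exists_neighbor X (Finset.mem_sdiff.1 he).1 he'.2
  have hZX : Z ≠ X := fun hc => he'.2 (by rw [← hZe, hc, he'.1])
  have hZY : Z = Y := by
    by_contra hZY
    exact hmin Z hZX hZY (conf_comp_of_erase_subset hZS hZ hZe)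
  rw [← hZY, hZ, Finset.card_singleton]

/-- A cocircuit has at most one neighbour on each side of a line. -/
theorem neighbor_unique {X Y Z : M.cocircuits} {e : E}
    (hY : M.cocircuitGraph.Adj X Y) (hZS : X.1.sep Z.1 = ∅)
    (hZ : X.1.zeros \ Z.1.zeros = {e}) (hYZ : Z.1 e = Y.1 e) : Z = Y := by
  by_contra hne
  refine hY.2.2 Z (fun hc => ?_) hne (conf_comp_of_erase_subset hZS hZ hYZ)
  rw [hc] at hZ
  simp at hZ

theorem card_moved_of_adj (h : M.IsGeneric k) {X Y : M.cocircuits}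
    (hadj : M.cocircuitGraph.Adj X Y) : (X.1.moved Y.1).card = 1 := by
  have := h.adj_iff.1 hadj
  rw [moved_eq_of_sep_eq_empty this.2, ← h.card_sdiff_comm, this.1]

/-- A step of a path brings exactly one new element to zero. -/
theorem card_moved_le_length (h : M.IsGeneric k) {X Y : M.cocircuits}
    (p : M.cocircuitGraph.Walk X Y) : (X.1.moved Y.1).card ≤ p.length := by
  induction p with
  | nil => simp [moved_self]
  | @cons X W Y hadj p ih =>
    have h1 := Finset.card_le_card (moved_subset X.1 W.1 Y.1)
    have h2 := Finset.card_union_le (X.1.moved W.1) (W.1.moved Y.1)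
    have h3 := h.card_moved_of_adj hadj
    rw [SimpleGraph.Walk.length_cons]
    omega

/-- Along the line through two cocircuits one exchange apart, the bound `card_moved_le_length` is
attained. -/
theorem exists_walk_of_collinear (h : M.IsGeneric k) {X Y : M.cocircuits}
    (hXY : (X.1.zeros \ Y.1.zeros).card = 1) :
    ∃ p : M.cocircuitGraph.Walk X Y, p.length = (X.1.moved Y.1).card := by
  induction hn : (X.1.moved Y.1).card using Nat.strong_induction_on generalizing X Y with
  | _ n ih =>
    by_cases hS : X.1.sep Y.1 = ∅
    · have hadj := h.adj_of_sep_eq_empty hXY hS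
      refine ⟨hadj.toWalk, ?_⟩
      rw [← hn, h.card_moved_of_adj hadj]
      rfl
    · obtain ⟨f, hf⟩ := Set.nonempty_iff_ne_empty.2 hS
      obtain ⟨W, hW, h1, h2, hsum⟩ := h.exists_between_card hXY hf
      have pos : ∀ {X Y : M.cocircuits}, (X.1.zeros \ Y.1.zeros).card = 1 →
          0 < (X.1.moved Y.1).card := by
        intro X Y hXY
        obtain ⟨g, hg⟩ := Finset.card_eq_one.1 ((h.card_sdiff_comm Y X).trans hXY)
        have hg' : g ∈ Y.1.zeros \ X.1.zeros := by simp [hg]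
        simp only [Finset.mem_sdiff, mem_zeros] at hg'
        exact Finset.card_pos.2 ⟨g, mem_moved.2 ⟨hg'.2, fun hc => hg'.2 (by rw [← hc, hg'.1])⟩⟩
      have := pos h1
      have := pos h2
      obtain ⟨p, hp⟩ := ih _ (by omega) h1 rfl
      obtain ⟨q, hq⟩ := ih _ (by omega) h2 rfl
      exact ⟨p.append q, by rw [SimpleGraph.Walk.length_append]; omega⟩

theorem connected (h : M.IsGeneric k) (hk : 0 < k) : M.cocircuitGraph.Connected := by
  have hcol : ∀ {X Y : M.cocircuits}, (X.1.zeros \ Y.1.zeros).card = 1 →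
      M.cocircuitGraph.Reachable X Y := fun hXY => ⟨(h.exists_walk_of_collinear hXY).choose⟩
  have hneg : ∀ X : M.cocircuits, M.cocircuitGraph.Reachable X (-X) := by
    intro X
    obtain ⟨e, he⟩ := Finset.card_pos.1 (by rw [h.card_zeros X]; exact hk)
    obtain ⟨Y, hY, _⟩ := h.exists_neighbor X he (one_ne_zero (α := SignType))
    have h1 : (X.1.zeros \ Y.1.zeros).card = 1 := by rw [hY]; simp
    exact (hcol h1).trans (hcol (by
      rw [coe_neg_cocircuit, zeros_neg, h.card_sdiff_comm, h1]))
  have key : ∀ (m : ℕ) (X Y : M.cocircuits), (X.1.zeros \ Y.1.zeros).card = m →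
      M.cocircuitGraph.Reachable X Y := by
    intro m
    induction m with
    | zero =>
      intro X Y hXY
      rw [Finset.card_eq_zero, Finset.sdiff_eq_empty_iff_subset] at hXY
      rcases h.cocircuit_eq_or_eq_neg (h.zeros_eq_of_subset hXY) with h1 | h1
      · rw [h1]
      · rw [h1]; exact hneg X
    | succ m ih =>
      intro X Y hXY
      obtain ⟨a, ha⟩ := Finset.card_pos.1 (by rw [hXY]; omega)
      obtain ⟨b, hb⟩ := Finset.card_pos.1 (by rw [h.card_sdiff_comm Y X, hXY]; omega)
      rw [Finset.mem_sdiff] at ha hb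
      have hcard : (insert b (X.1.zeros.erase a)).card = k := by
        rw [Finset.card_insert_of_notMem fun hc => hb.2 (Finset.mem_of_mem_erase hc),
          Finset.card_erase_add_one ha.1, h.card_zeros]
      obtain ⟨W, hW⟩ := h.exists_cocircuit_zeros' hcard
      have hab : a ≠ b := fun hc => hb.2 (hc ▸ ha.1)
      have h1 : X.1.zeros \ W.1.zeros = {a} :=
        sdiff_eq_singleton_of_erase_subset ha.1 (by simp [hW, hab])
          (hW ▸ Finset.subset_insert _ _)
      have h2 : W.1.zeros \ Y.1.zeros = (X.1.zeros \ Y.1.zeros).erase a := by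
        ext g
        simp only [hW, Finset.mem_sdiff, Finset.mem_insert, Finset.mem_erase]
        constructor
        · rintro ⟨rfl | h3, h4⟩
          · exact absurd hb.1 h4
          · exact ⟨h3.1, h3.2, h4⟩
        · rintro ⟨h3, h4, h5⟩; exact ⟨Or.inr ⟨h3, h4⟩, h5⟩
      refine (hcol (by rw [h1]; simp)).trans (ih W Y ?_)
      rw [h2, Finset.card_erase_of_mem (Finset.mem_sdiff.2 ha), hXY]
      rfl
  have : Nonempty M.cocircuits := by
    obtain ⟨A, _, hA⟩ := Finset.exists_subset_card_eq
      (show k ≤ (Finset.univ : Finset E).card from h.lt_card.le)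
    exact ⟨(h.exists_cocircuit_zeros' hA).choose⟩
  exact ⟨fun X Y => key _ X Y rfl⟩

theorem card_moved_le_dist (h : M.IsGeneric k) (hk : 0 < k) (X Y : M.cocircuits) :
    (X.1.moved Y.1).card ≤ M.cocircuitGraph.dist X Y := by
  obtain ⟨p, hp⟩ := (h.connected hk).exists_walk_length_eq_dist X Y
  exact hp ▸ h.card_moved_le_length p

theorem dist_of_collinear (h : M.IsGeneric k) (hk : 0 < k) {X Y : M.cocircuits}
    (hXY : (X.1.zeros \ Y.1.zeros).card = 1) :
    M.cocircuitGraph.dist X Y = (X.1.moved Y.1).card := by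
  refine le_antisymm ?_ (h.card_moved_le_dist hk X Y)
  obtain ⟨p, hp⟩ := h.exists_walk_of_collinear hXY
  exact hp ▸ SimpleGraph.dist_le p

theorem card_moved_add (h : M.IsGeneric k) (X Y : M.cocircuits) :
    (X.1.moved Y.1).card + (Y.1.moved (-X.1)).card + k =
      Fintype.card E + (X.1.zeros \ Y.1.zeros).card := by
  have h1 := card_moved_add_card_moved_neg X.1 Y.1
  have h2 := Finset.card_sdiff_add_card_inter X.1.zeros Y.1.zeros
  rw [h.card_zeros] at h2
  omega

theorem dist_add_dist_neg (h : M.IsGeneric k) (hk : 0 < k) {X Y : M.cocircuits}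
    (hXY : (X.1.zeros \ Y.1.zeros).card = 1) :
    M.cocircuitGraph.dist X Y + M.cocircuitGraph.dist Y (-X) + k = Fintype.card E + 1 := by
  rw [h.dist_of_collinear hk hXY, h.dist_of_collinear hk (Y := -X)
    (by rw [coe_neg_cocircuit, zeros_neg, h.card_sdiff_comm, hXY]), coe_neg_cocircuit,
    h.card_moved_add, hXY]

/-- Antipodal cocircuits have distance `n - k + 1`: besides all elements outside the zero set, the
element that leaves the zero set in the first step has to become zero on the way. -/
theorem dist_neg (h : M.IsGeneric k) (hk : 0 < k) (X : M.cocircuits) :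
    M.cocircuitGraph.dist X (-X) + k = Fintype.card E + 1 := by
  apply le_antisymm
  · obtain ⟨e, he⟩ := Finset.card_pos.1 (by rw [h.card_zeros X]; exact hk)
    obtain ⟨Y, hY, _⟩ := h.exists_neighbor X he (one_ne_zero (α := SignType))
    rw [← h.dist_add_dist_neg hk (X := X) (Y := Y) (by rw [hY]; simp)]
    exact Nat.add_le_add_right (h.connected hk).dist_triangle k
  · obtain ⟨p, hp⟩ := (h.connected hk).exists_walk_length_eq_dist X (-X)
    rw [← hp]
    have key : ∀ (Z : M.cocircuits) (q : M.cocircuitGraph.Walk X Z), Z = -X →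
        Fintype.card E + 1 ≤ q.length + k := by
      intro Z q hZ
      cases q with
      | nil => exact absurd hZ (cocircuit_ne_neg X)
      | @cons _ Y _ hadj q =>
        subst hZ
        have h1 := h.card_moved_of_adj hadj
        have h2 := h.card_moved_le_length q
        have h3 := h.card_moved_add X Y
        rw [(h.adj_iff.1 hadj).1] at h3
        rw [coe_neg_cocircuit] at h2
        rw [SimpleGraph.Walk.length_cons]
        omega
    exact key _ p rfl

end IsGeneric

end OrientedMatroid

/-! ### Closeness of three zero sets, read off the metric -/

namespace OrientedMatroid

open SignVec

variable {E : Type*} [Fintype E] [DecidableEq E] {M : OrientedMatroid E} {k : ℕ}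

namespace IsGeneric

theorem eq_of_card_sdiff_eq_zero (h : M.IsGeneric k) {X Y : M.cocircuits}
    (hXY : (X.1.zeros \ Y.1.zeros).card = 0) : X.1.zeros = Y.1.zeros :=
  h.zeros_eq_of_subset (Finset.sdiff_eq_empty_iff_subset.1 (Finset.card_eq_zero.1 hXY))

/-- On a path from `X` through `Y` and `Z` to `-X`, only the common zeros of the three need
not be moved. -/
theorem le_card_moved_add_card_moved (h : M.IsGeneric k) (X Y Z : M.cocircuits) :
    Fintype.card E + (X.1.zeros \ (Y.1.zeros ∩ Z.1.zeros)).card ≤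
      (X.1.moved Y.1).card + (Y.1.moved Z.1).card + (Z.1.moved (-X.1)).card + k := by
  have hsub : (X.1.zeros ∩ (Y.1.zeros ∩ Z.1.zeros))ᶜ ⊆
      X.1.moved Y.1 ∪ Y.1.moved Z.1 ∪ Z.1.moved (-X.1) := by
    intro e
    simp only [Finset.mem_compl, Finset.mem_inter, Finset.mem_union, mem_moved, mem_zeros,
      Pi.neg_apply]
    generalize X.1 e = x
    generalize Y.1 e = y
    generalize Z.1 e = z
    revert x y z
    decide
  have h1 := Finset.card_le_card hsub
  have h2 := Finset.card_union_le (X.1.moved Y.1 ∪ Y.1.moved Z.1) (Z.1.moved (-X.1))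
  have h3 := Finset.card_union_le (X.1.moved Y.1) (Y.1.moved Z.1)
  have h4 := Finset.card_sdiff_add_card_inter X.1.zeros (Y.1.zeros ∩ Z.1.zeros)
  rw [h.card_zeros] at h4
  rw [Finset.card_compl] at h1
  omega

/-- That the zero set of `X` loses at most one element on intersection with those of `Y` and `Z` is
visible in the metric of the cocircuit graph together with the antipodal map: up to signs, `Y` and
`Z` lie in this order on a shortest path from `X` to `-X`. -/
theorem card_sdiff_inter_le_one_iff (h : M.IsGeneric k) (hk : 0 < k) (X Y Z : M.cocircuits) :
    (X.1.zeros \ (Y.1.zeros ∩ Z.1.zeros)).card ≤ 1 ↔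
      ∃ Y' Z' : M.cocircuits, (Y' = Y ∨ Y' = -Y) ∧ (Z' = Z ∨ Z' = -Z) ∧
        M.cocircuitGraph.dist X Y' + M.cocircuitGraph.dist Y' Z' + M.cocircuitGraph.dist Z' (-X) ≤
          M.cocircuitGraph.dist X (-X) := by
  have hD := h.dist_neg hk X
  constructor
  · intro hc
    have hY : (X.1.zeros \ Y.1.zeros).card ≤ 1 := (Finset.card_le_card
      (Finset.sdiff_subset_sdiff subset_rfl Finset.inter_subset_left)).trans hc
    have hZ : (X.1.zeros \ Z.1.zeros).card ≤ 1 := (Finset.card_le_card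
      (Finset.sdiff_subset_sdiff subset_rfl Finset.inter_subset_right)).trans hc
    rcases Nat.le_one_iff_eq_zero_or_eq_one.1 hY with hY0 | hY1
    · have hXY : X = Y ∨ X = -Y :=
        h.cocircuit_eq_or_eq_neg (h.eq_of_card_sdiff_eq_zero hY0).symm
      rcases Nat.le_one_iff_eq_zero_or_eq_one.1 hZ with hZ0 | hZ1
      · refine ⟨X, -X, hXY, ?_, by simp⟩
        rcases h.cocircuit_eq_or_eq_neg (h.eq_of_card_sdiff_eq_zero hZ0) with h1 | h1
        · exact Or.inr (by rw [h1])
        · exact Or.inl h1.symm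
      · refine ⟨X, Z, hXY, Or.inl rfl, ?_⟩
        have := h.dist_add_dist_neg hk hZ1
        rw [SimpleGraph.dist_self]
        omega
    · rcases Nat.le_one_iff_eq_zero_or_eq_one.1 hZ with hZ0 | hZ1
      · refine ⟨Y, -X, Or.inl rfl, ?_, ?_⟩
        · rcases h.cocircuit_eq_or_eq_neg (h.eq_of_card_sdiff_eq_zero hZ0) with h1 | h1
          · exact Or.inr (by rw [h1])
          · exact Or.inl h1.symm
        · have := h.dist_add_dist_neg hk hY1
          rw [SimpleGraph.dist_self]
          omega
      by_cases hYZ : Y.1.zeros = Z.1.zeros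
      · refine ⟨Y, Y, Or.inl rfl, h.cocircuit_eq_or_eq_neg hYZ.symm, ?_⟩
        have := h.dist_add_dist_neg hk hY1
        rw [SimpleGraph.dist_self]
        omega
      obtain ⟨e, he⟩ := Finset.card_eq_one.1 hY1
      have heZ : X.1.zeros \ Z.1.zeros = {e} := by
        have h1 : X.1.zeros \ Y.1.zeros = X.1.zeros \ (Y.1.zeros ∩ Z.1.zeros) :=
          Finset.eq_of_subset_of_card_le
            (Finset.sdiff_subset_sdiff subset_rfl Finset.inter_subset_left) (by omega)
        have h2 : X.1.zeros \ Z.1.zeros = X.1.zeros \ (Y.1.zeros ∩ Z.1.zeros) :=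
          Finset.eq_of_subset_of_card_le
            (Finset.sdiff_subset_sdiff subset_rfl Finset.inter_subset_right) (by omega)
        rw [h2, ← h1, he]
      obtain ⟨a, ha⟩ := Finset.card_eq_one.1 ((h.card_sdiff_comm Z X).trans hZ1)
      have haZ : a ∈ Z.1.zeros ∧ a ∉ X.1.zeros := by
        rw [← Finset.mem_sdiff, ha]; exact Finset.mem_singleton_self a
      have hXYZ : X.1.zeros ∩ Y.1.zeros ⊆ Z.1.zeros := by
        intro f hf
        rw [Finset.mem_inter] at hf
        by_contra hfZ
        have : f ∈ X.1.zeros \ Y.1.zeros := by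
          rw [he, ← heZ]; exact Finset.mem_sdiff.2 ⟨hf.1, hfZ⟩
        exact (Finset.mem_sdiff.1 this).2 hf.2
      have haY : a ∉ Y.1.zeros := by
        intro haY
        refine hYZ (h.zeros_eq_of_subset fun f hf => ?_)
        by_cases hfX : f ∈ X.1.zeros
        · exact hXYZ (Finset.mem_inter.2 ⟨hfX, hf⟩)
        · have h1 : (Y.1.zeros \ X.1.zeros).card ≤ 1 := by rw [h.card_sdiff_comm, hY1]
          rw [Finset.card_le_one.1 h1 f (Finset.mem_sdiff.2 ⟨hf, hfX⟩) a
            (Finset.mem_sdiff.2 ⟨haY, haZ.2⟩)]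
          exact haZ.1
      -- with `Y'` on the side of `X` at `a`, the cocircuit of the line vanishing at `a`, which is
      -- `Z` up to sign, lies between `Y'` and `-X`
      obtain ⟨Y', hY', hYa⟩ : ∃ Y' : M.cocircuits, (Y' = Y ∨ Y' = -Y) ∧ Y'.1 a = X.1 a := by
        rcases eq_or_eq_neg_of_ne_zero (x := X.1 a) (y := Y.1 a) (by simpa using haZ.2)
          (by simpa using haY) with h1 | h1
        · exact ⟨Y, Or.inl rfl, h1⟩
        · exact ⟨-Y, Or.inr rfl, by rw [coe_neg_cocircuit, Pi.neg_apply, h1, neg_neg]⟩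
      have hzY : Y'.1.zeros = Y.1.zeros := by
        rcases hY' with rfl | rfl
        · rfl
        · rw [coe_neg_cocircuit, zeros_neg]
      have hcY : (Y'.1.zeros \ (-X : M.cocircuits).1.zeros).card = 1 := by
        rw [coe_neg_cocircuit, zeros_neg, hzY, h.card_sdiff_comm, hY1]
      obtain ⟨W, hW, hW1, hW2, hW3⟩ := h.exists_between_card (X := Y') (Y := -X) hcY (f := a)
        (mem_sep.2 ⟨by simp [hYa], by rw [hYa]; simpa using haZ.2⟩)
      have hWZ : W.1.zeros = Z.1.zeros := by
        refine h.zeros_eq_of_subset ?_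
        rw [hW, coe_neg_cocircuit, zeros_neg, hzY, Finset.inter_comm]
        exact Finset.insert_subset haZ.1 hXYZ
      refine ⟨Y', W, hY', h.cocircuit_eq_or_eq_neg hWZ.symm, ?_⟩
      rw [h.dist_of_collinear hk hW1, h.dist_of_collinear hk hW2, add_assoc, hW3,
        ← h.dist_of_collinear hk hcY]
      have := h.dist_add_dist_neg hk (X := X) (Y := Y') (by rw [hzY, hY1])
      omega
  · rintro ⟨Y', Z', hY, hZ, hle⟩
    have hzY : Y'.1.zeros = Y.1.zeros := by
      rcases hY with rfl | rfl
      · rfl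
      · rw [coe_neg_cocircuit, zeros_neg]
    have hzZ : Z'.1.zeros = Z.1.zeros := by
      rcases hZ with rfl | rfl
      · rfl
      · rw [coe_neg_cocircuit, zeros_neg]
    have h1 := h.le_card_moved_add_card_moved X Y' Z'
    have h2 := h.card_moved_le_dist hk X Y'
    have h3 := h.card_moved_le_dist hk Y' Z'
    have h4 := h.card_moved_le_dist hk Z' (-X)
    rw [coe_neg_cocircuit] at h4
    rw [hzY, hzZ] at h1
    omega

end IsGeneric

end OrientedMatroid

/-! ### Bijections between the `k`-sets of two finite sets -/

section Exchange

variable {V W E F : Type*} [DecidableEq E] [DecidableEq F]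

/-- A bijection `f` between families of `k`-sets and of `l`-sets (with repetitions), both families
containing all sets of their size, that respects equality and the ternary relation
`|A \ (B ∩ C)| ≤ 1`. -/
structure IsStarEquiv [Fintype E] [Fintype F] (k l : ℕ) (z : V → Finset E) (w : W → Finset F)
    (f : V ≃ W) : Prop where
  pos_left : 0 < k
  pos_right : 0 < l
  lt_left : k < Fintype.card E
  lt_right : l < Fintype.card F
  card_left : ∀ X, (z X).card = k
  card_right : ∀ X, (w X).card = l
  surj_left : ∀ A : Finset E, A.card = k → ∃ X, z X = A
  surj_right : ∀ A : Finset F, A.card = l → ∃ X, w X = A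
  eq_iff : ∀ X Y, z X = z Y ↔ w (f X) = w (f Y)
  star_iff : ∀ X Y Z, (z X \ (z Y ∩ z Z)).card ≤ 1 ↔ (w (f X) \ (w (f Y) ∩ w (f Z))).card ≤ 1

namespace IsStarEquiv

variable [Fintype E] [Fintype F] {k l : ℕ} {z : V → Finset E} {w : W → Finset F} {f : V ≃ W}

theorem symm (h : IsStarEquiv k l z w f) : IsStarEquiv l k w z f.symm where
  pos_left := h.pos_right
  pos_right := h.pos_left
  lt_left := h.lt_right
  lt_right := h.lt_left
  card_left := h.card_right
  card_right := h.card_left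
  surj_left := h.surj_right
  surj_right := h.surj_left
  eq_iff X Y := by rw [h.eq_iff, f.apply_symm_apply, f.apply_symm_apply]
  star_iff X Y Z := by
    rw [h.star_iff, f.apply_symm_apply, f.apply_symm_apply, f.apply_symm_apply]

theorem exists_sdiff_eq_singleton (h : IsStarEquiv k l z w f) {X Y : V} {e : E}
    (hXY : z X \ z Y = {e}) : ∃ p, w (f X) \ w (f Y) = {p} := by
  rw [← Finset.card_eq_one]
  have h1 : (z X \ (z Y ∩ z Y)).card ≤ 1 := by rw [Finset.inter_self, hXY]; simp
  rw [h.star_iff, Finset.inter_self] at h1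
  refine le_antisymm h1 (Finset.card_pos.2 ?_)
  rw [Finset.nonempty_iff_ne_empty, Ne, Finset.sdiff_eq_empty_iff_subset]
  intro hs
  have h2 := (h.eq_iff X Y).2
    (Finset.eq_of_subset_of_card_le hs (by rw [h.card_right, h.card_right]))
  rw [h2, Finset.sdiff_self] at hXY
  exact absurd hXY.symm (Finset.singleton_ne_empty e)

/-- The element leaving `w (f X)` depends only on `X` and the element leaving `z X`. -/
theorem sdiff_eq_of_sdiff_eq (h : IsStarEquiv k l z w f) {X Y Z : V} {e : E} {p : F}
    (hY : z X \ z Y = {e}) (hZ : z X \ z Z = {e}) (hp : w (f X) \ w (f Y) = {p}) :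
    w (f X) \ w (f Z) = {p} := by
  obtain ⟨q, hq⟩ := h.exists_sdiff_eq_singleton hZ
  have h1 : (z X \ (z Y ∩ z Z)).card ≤ 1 := by
    rw [Finset.sdiff_inter_distrib_right, hY, hZ]; simp
  rw [h.star_iff, Finset.sdiff_inter_distrib_right, hp, hq] at h1
  rw [hq, Finset.card_le_one.1 h1 q (by simp) p (by simp)]

theorem exists_sdiff_singleton (h : IsStarEquiv k l z w f) {X : V} {e : E} (he : e ∈ z X) :
    ∃ Y, z X \ z Y = {e} := by
  obtain ⟨g, hg⟩ : ∃ g, g ∉ z X := by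
    by_contra hcon
    push Not at hcon
    have := h.lt_left
    rw [← h.card_left X, Finset.eq_univ_of_forall hcon, Finset.card_univ] at this
    exact lt_irrefl _ this
  obtain ⟨Y, hY⟩ := h.surj_left (insert g ((z X).erase e)) (by
    rw [Finset.card_insert_of_notMem (fun hc => hg (Finset.mem_of_mem_erase hc)),
      Finset.card_erase_add_one he, h.card_left])
  refine ⟨Y, ?_⟩
  ext a
  rw [hY]
  simp only [Finset.mem_sdiff, Finset.mem_insert, Finset.mem_erase, Finset.mem_singleton]
  constructor
  · rintro ⟨h1, h2⟩
    by_contra hne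
    exact h2 (Or.inr ⟨hne, h1⟩)
  · rintro rfl
    exact ⟨he, by rintro (rfl | hc) <;> tauto⟩

/-- If two `k`-sets through `e` differ by one exchange, the union minus `e` is a `k`-set that
differs from either by removing `e`. Pairwise, but not in the ternary sense, these three are close,
and the same holds for their images; hence the same element leaves both images. -/
theorem sdiff_eq_of_card_sdiff_eq_one (h : IsStarEquiv k l z w f) {X X' Y Y' : V} {e : E} {p : F}
    (hXX' : (z X \ z X').card = 1) (hY : z X \ z Y = {e}) (hY' : z X' \ z Y' = {e})
    (hp : w (f X) \ w (f Y) = {p}) : w (f X') \ w (f Y') = {p} := by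
  have heX : e ∈ z X := (Finset.mem_sdiff.1 (hY ▸ Finset.mem_singleton_self e)).1
  have heX' : e ∈ z X' := (Finset.mem_sdiff.1 (hY' ▸ Finset.mem_singleton_self e)).1
  obtain ⟨a, ha⟩ := Finset.card_eq_one.1 hXX'
  have haX : a ∈ z X ∧ a ∉ z X' := Finset.mem_sdiff.1 (ha ▸ Finset.mem_singleton_self a)
  have hae : a ≠ e := by rintro rfl; exact haX.2 heX'
  have hcard : (z X' ∪ z X).card = k + 1 := by
    rw [← Finset.union_sdiff_self_eq_union, Finset.card_union_of_disjoint Finset.disjoint_sdiff,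
      h.card_left, hXX']
  obtain ⟨Z, hZ⟩ := h.surj_left ((z X' ∪ z X).erase e) (by
    rw [Finset.card_erase_of_mem (Finset.mem_union_left _ heX'), hcard, Nat.add_sub_cancel])
  have hXZ : z X \ z Z = {e} := by
    ext b
    simp only [hZ, Finset.mem_sdiff, Finset.mem_erase, Finset.mem_union, Finset.mem_singleton]
    constructor
    · rintro ⟨h1, h2⟩
      by_contra hne
      exact h2 ⟨hne, Or.inr h1⟩
    · rintro rfl
      exact ⟨heX, fun hc => hc.1 rfl⟩
  have hXZ' : z X' \ z Z = {e} := by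
    ext b
    simp only [hZ, Finset.mem_sdiff, Finset.mem_erase, Finset.mem_union, Finset.mem_singleton]
    constructor
    · rintro ⟨h1, h2⟩
      by_contra hne
      exact h2 ⟨hne, Or.inl h1⟩
    · rintro rfl
      exact ⟨heX', fun hc => hc.1 rfl⟩
  have h1 := h.sdiff_eq_of_sdiff_eq hY hXZ hp
  obtain ⟨q, hq⟩ := h.exists_sdiff_eq_singleton hXZ'
  obtain ⟨r, hr⟩ := h.exists_sdiff_eq_singleton ha
  have hrp : r ≠ p := by
    rintro rfl
    have h2 : (w (f X) \ (w (f X') ∩ w (f Z))).card ≤ 1 := by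
      rw [Finset.sdiff_inter_distrib_right, hr, h1]; simp
    rw [← h.star_iff, Finset.sdiff_inter_distrib_right, ha, hXZ] at h2
    exact hae (Finset.card_le_one.1 h2 a (by simp) e (by simp))
  have hpX : p ∈ w (f X) ∧ p ∉ w (f Z) := Finset.mem_sdiff.1 (h1 ▸ Finset.mem_singleton_self p)
  have hpX' : p ∈ w (f X') := by
    by_contra hc
    have : p ∈ w (f X) \ w (f X') := Finset.mem_sdiff.2 ⟨hpX.1, hc⟩
    rw [hr, Finset.mem_singleton] at this
    exact hrp this.symm
  have hpq : p ∈ w (f X') \ w (f Z) := Finset.mem_sdiff.2 ⟨hpX', hpX.2⟩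
  rw [hq, Finset.mem_singleton] at hpq
  rw [← hpq] at hq
  exact h.sdiff_eq_of_sdiff_eq hXZ' hY' hq

/-- The element leaving the image depends only on the element leaving the preimage: any two
`k`-sets through `e` are connected by exchanges that keep `e`. -/
theorem sdiff_eq_of_mem (h : IsStarEquiv k l z w f) {X X' Y Y' : V} {e : E} {p : F}
    (hY : z X \ z Y = {e}) (hY' : z X' \ z Y' = {e})
    (hp : w (f X) \ w (f Y) = {p}) : w (f X') \ w (f Y') = {p} := by
  induction hn : (z X \ z X').card generalizing X Y with
  | zero =>
    have hXX' : z X = z X' := Finset.eq_of_subset_of_card_le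
      (Finset.sdiff_eq_empty_iff_subset.1 (Finset.card_eq_zero.1 hn))
      (by rw [h.card_left, h.card_left])
    rw [(h.eq_iff X X').1 hXX'] at hp
    rw [hXX'] at hY
    exact h.sdiff_eq_of_sdiff_eq hY hY' hp
  | succ n ih =>
    have heX : e ∈ z X := (Finset.mem_sdiff.1 (hY ▸ Finset.mem_singleton_self e)).1
    have heX' : e ∈ z X' := (Finset.mem_sdiff.1 (hY' ▸ Finset.mem_singleton_self e)).1
    obtain ⟨a, ha⟩ : (z X \ z X').Nonempty := Finset.card_pos.1 (by omega)
    obtain ⟨b, hb⟩ : (z X' \ z X).Nonempty := Finset.card_pos.1 (by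
      rw [Finset.card_sdiff_comm ((h.card_left X').trans (h.card_left X).symm)]; omega)
    rw [Finset.mem_sdiff] at ha hb
    obtain ⟨X'', hX''⟩ := h.surj_left (insert b ((z X).erase a)) (by
      rw [Finset.card_insert_of_notMem (fun hc => hb.2 (Finset.mem_of_mem_erase hc)),
        Finset.card_erase_add_one ha.1, h.card_left])
    have h1 : z X \ z X'' = {a} := by
      ext c
      rw [hX'']
      simp only [Finset.mem_sdiff, Finset.mem_insert, Finset.mem_erase, Finset.mem_singleton]
      constructor
      · rintro ⟨h1, h2⟩
        by_contra hne
        exact h2 (Or.inr ⟨hne, h1⟩)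
      · rintro rfl
        exact ⟨ha.1, by rintro (rfl | hc) <;> tauto⟩
    have h2 : z X'' \ z X' = (z X \ z X').erase a := by
      ext c
      rw [hX'']
      simp only [Finset.mem_sdiff, Finset.mem_insert, Finset.mem_erase]
      constructor
      · rintro ⟨rfl | h1, h2⟩
        · exact absurd hb.1 h2
        · exact ⟨h1.1, h1.2, h2⟩
      · rintro ⟨h1, h2, h3⟩
        exact ⟨Or.inr ⟨h1, h2⟩, h3⟩
    have heX'' : e ∈ z X'' := by
      rw [hX'']
      refine Finset.mem_insert_of_mem (Finset.mem_erase.2 ⟨?_, heX⟩)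
      rintro rfl
      exact ha.2 heX'
    obtain ⟨Y'', hY''⟩ := h.exists_sdiff_singleton heX''
    refine ih hY'' (h.sdiff_eq_of_card_sdiff_eq_one (by rw [h1]; simp) hY hY'' hp) ?_
    rw [h2, Finset.card_erase_of_mem (Finset.mem_sdiff.2 ha), hn, Nat.add_sub_cancel]

theorem exists_mem (h : IsStarEquiv k l z w f) (e : E) : ∃ X, e ∈ z X := by
  obtain ⟨A, hA, hAk⟩ := Finset.exists_superset_card_eq (s := {e}) (n := k)
    (by rw [Finset.card_singleton]; exact h.pos_left) h.lt_left.le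
  obtain ⟨X, hX⟩ := h.surj_left A hAk
  exact ⟨X, hX ▸ hA (Finset.mem_singleton_self e)⟩

theorem exists_image (h : IsStarEquiv k l z w f) (e : E) :
    ∃ p : F, ∀ X Y, z X \ z Y = {e} → w (f X) \ w (f Y) = {p} := by
  obtain ⟨X, hX⟩ := h.exists_mem e
  obtain ⟨Y, hY⟩ := h.exists_sdiff_singleton hX
  obtain ⟨p, hp⟩ := h.exists_sdiff_eq_singleton hY
  exact ⟨p, fun X' Y' h' => h.sdiff_eq_of_mem hY h' hp⟩

/-- A bijection of `k`-sets preserving the ternary closeness relation is induced by a bijection of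
the ground sets. -/
theorem exists_equiv (h : IsStarEquiv k l z w f) :
    ∃ φ : E ≃ F, ∀ X e, e ∈ z X ↔ φ e ∈ w (f X) := by
  choose φ hφ using h.exists_image
  choose ψ hψ using h.symm.exists_image
  have h1 : ∀ e, ψ (φ e) = e := by
    intro e
    obtain ⟨X, hX⟩ := h.exists_mem e
    obtain ⟨Y, hY⟩ := h.exists_sdiff_singleton hX
    have := hψ (φ e) (f X) (f Y) (hφ e X Y hY)
    rw [f.symm_apply_apply, f.symm_apply_apply, hY] at this
    exact (Finset.singleton_injective this).symm
  have h2 : ∀ p, φ (ψ p) = p := by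
    intro p
    obtain ⟨X, hX⟩ := h.symm.exists_mem p
    obtain ⟨Y, hY⟩ := h.symm.exists_sdiff_singleton hX
    have := hφ (ψ p) (f.symm X) (f.symm Y) (hψ p X Y hY)
    rw [f.apply_symm_apply, f.apply_symm_apply, hY] at this
    exact (Finset.singleton_injective this).symm
  refine ⟨⟨φ, ψ, h1, h2⟩, fun X e => ⟨fun he => ?_, fun he => ?_⟩⟩
  · obtain ⟨Y, hY⟩ := h.exists_sdiff_singleton he
    have := hφ e X Y hY
    exact (Finset.mem_sdiff.1 (this ▸ Finset.mem_singleton_self (φ e))).1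
  · obtain ⟨Y, hY⟩ := h.symm.exists_sdiff_singleton (X := f X) (e := φ e) he
    have := hψ (φ e) (f X) Y hY
    rw [h1, f.symm_apply_apply] at this
    exact (Finset.mem_sdiff.1 (this ▸ Finset.mem_singleton_self e)).1

end IsStarEquiv

end Exchange

/-! ### Characterization of the antipodal map -/

section Metric

theorem SimpleGraph.Connected.dist_map_le {V W : Type*} {G : SimpleGraph V} {H : SimpleGraph W}
    (hG : G.Connected) (f : G →g H) (u v : V) : H.dist (f u) (f v) ≤ G.dist u v := by
  obtain ⟨p, hp⟩ := hG.exists_walk_length_eq_dist u v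
  rw [← hp, ← SimpleGraph.Walk.length_map f p]
  exact SimpleGraph.dist_le _

theorem SimpleGraph.Connected.dist_iso {V W : Type*} {G : SimpleGraph V} {H : SimpleGraph W}
    (hG : G.Connected) (hH : H.Connected) (f : G ≃g H) (u v : V) :
    H.dist (f u) (f v) = G.dist u v := by
  refine le_antisymm (hG.dist_map_le f.toHom u v) ?_
  have := hH.dist_map_le f.symm.toHom (f u) (f v)
  simpa using this

end Metric

namespace OrientedMatroid

open SignVec

variable {E F : Type*} [Fintype E] [DecidableEq E] [Fintype F] [DecidableEq F]
  {M : OrientedMatroid E} {N : OrientedMatroid F} {k l : ℕ}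

namespace IsGeneric

/-- An isomorphism of cocircuit graphs that commutes with the antipodal maps is, on zero sets,
induced by a bijection of the ground sets. -/
theorem exists_equiv_of_antipodal (hM : M.IsGeneric k) (hN : N.IsGeneric l) (hk : 0 < k)
    (hl : 0 < l) (f : M.cocircuitGraph ≃g N.cocircuitGraph) (hf : ∀ X, f (-X) = -f X) :
    ∃ φ : E ≃ F, ∀ X e, e ∈ X.1.zeros ↔ φ e ∈ (f X).1.zeros := by
  have hd := (hM.connected hk).dist_iso (hN.connected hl) f
  refine IsStarEquiv.exists_equiv (k := k) (l := l) (z := fun X : M.cocircuits => X.1.zeros)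
    (w := fun X : N.cocircuits => X.1.zeros) (f := f.toEquiv)
    ⟨hk, hl, hM.lt_card, hN.lt_card, hM.card_zeros, hN.card_zeros,
      fun A hA => hM.exists_cocircuit_zeros' hA, fun A hA => hN.exists_cocircuit_zeros' hA, ?_, ?_⟩
  · intro X Y
    change _ ↔ (f X).1.zeros = (f Y).1.zeros
    rw [hM.zeros_eq_iff, hN.zeros_eq_iff, ← hf, f.injective.eq_iff, f.injective.eq_iff]
  · intro X Y Z
    change _ ↔ ((f X).1.zeros \ ((f Y).1.zeros ∩ (f Z).1.zeros)).card ≤ 1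
    rw [hM.card_sdiff_inter_le_one_iff hk, hN.card_sdiff_inter_le_one_iff hl]
    constructor
    · rintro ⟨Y', Z', hY, hZ, hle⟩
      refine ⟨f Y', f Z', ?_, ?_, ?_⟩
      · rwa [← hf, f.injective.eq_iff, f.injective.eq_iff]
      · rwa [← hf, f.injective.eq_iff, f.injective.eq_iff]
      · rwa [← hf, hd, hd, hd, hd]
    · rintro ⟨Y', Z', hY, hZ, hle⟩
      obtain ⟨Y', rfl⟩ := f.surjective Y'
      obtain ⟨Z', rfl⟩ := f.surjective Z'
      rw [← hf, f.injective.eq_iff, f.injective.eq_iff] at hY hZ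
      rw [← hf, hd, hd, hd, hd] at hle
      exact ⟨Y', Z', hY, hZ, hle⟩

end IsGeneric

/-- An involution of a finite set has, in every size, a subset from which it maps at most one
element out: add orbits, the last one possibly only in part. -/
theorem exists_card_sdiff_map_le_one (φ : E ≃ E) (hφ : ∀ e, φ (φ e) = e) (k : ℕ)
    (hk : k ≤ Fintype.card E) :
    ∃ A : Finset E, A.card = k ∧ (A.filter fun e => φ e ∉ A).card ≤ 1 := by
  induction k with
  | zero => exact ⟨∅, by simp⟩
  | succ k ih =>
    obtain ⟨A, hA, hA1⟩ := ih (by omega)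
    rcases Finset.eq_empty_or_nonempty (A.filter fun e => φ e ∉ A) with h0 | ⟨a, ha⟩
    · obtain ⟨e, he⟩ : ∃ e, e ∉ A := by
        by_contra hcon
        push Not at hcon
        rw [Finset.eq_univ_of_forall hcon, Finset.card_univ] at hA
        omega
      refine ⟨insert e A, by rw [Finset.card_insert_of_notMem he, hA], ?_⟩
      rw [← Finset.card_singleton e]
      refine Finset.card_le_card fun b hb => ?_
      rw [Finset.mem_filter, Finset.mem_insert, Finset.mem_insert, not_or] at hb
      rcases hb.1 with rfl | hbA
      · simp
      · exact absurd (Finset.mem_filter.2 ⟨hbA, hb.2.2⟩) (by rw [h0]; simp)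
    · have ha' := Finset.mem_filter.1 ha
      refine ⟨insert (φ a) A, by rw [Finset.card_insert_of_notMem ha'.2, hA], ?_⟩
      rw [Finset.card_le_one]
      have hempty : ∀ b ∈ insert (φ a) A, φ b ∈ insert (φ a) A := by
        intro b hb
        rcases Finset.mem_insert.1 hb with rfl | hb
        · rw [hφ]; exact Finset.mem_insert_of_mem ha'.1
        · by_cases hbA : φ b ∈ A
          · exact Finset.mem_insert_of_mem hbA
          · rw [Finset.card_le_one.1 hA1 b (Finset.mem_filter.2 ⟨hb, hbA⟩) a ha]
            exact Finset.mem_insert_self _ _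
      intro b hb
      rw [Finset.mem_filter] at hb
      exact absurd (hempty b hb.1) hb.2

namespace IsGeneric

theorem dist_neg_eq (h : M.IsGeneric k) (hk : 0 < k) (X Y : M.cocircuits) :
    M.cocircuitGraph.dist X (-X) = M.cocircuitGraph.dist Y (-Y) := by
  have h1 := h.dist_neg hk X
  have h2 := h.dist_neg hk Y
  omega

/-- Among the cocircuits whose zero set is that of `X` up to one exchange, only `-X` is as far
from `X` as `-X`. -/
theorem eq_neg_of_dist_neg_le_dist (h : M.IsGeneric k) (hk : 0 < k) {X Y : M.cocircuits}
    (hXY : (X.1.zeros \ Y.1.zeros).card ≤ 1)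
    (hd : M.cocircuitGraph.dist X (-X) ≤ M.cocircuitGraph.dist X Y) : Y = -X := by
  have h1 := h.dist_neg hk X
  rcases Nat.le_one_iff_eq_zero_or_eq_one.1 hXY with h0 | h0
  · refine (h.cocircuit_eq_or_eq_neg (h.eq_of_card_sdiff_eq_zero h0)).resolve_left ?_
    rintro rfl
    rw [SimpleGraph.dist_self, Nat.le_zero, (h.connected hk).dist_eq_zero_iff] at hd
    exact cocircuit_ne_neg Y hd
  · have h2 := h.dist_add_dist_neg hk h0
    exact (h.connected hk).dist_eq_zero_iff.1 (by omega)

/-- If `U` is a neighbour of `-X` and its zero set is not too close to that of a neighbour `Y` of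
`X`, then going from `Y` to the line through `X` and `U`, and along this line to `U`, is shorter
than going to `-Y`. -/
theorem dist_lt_of_adj_of_adj_neg (h : M.IsGeneric k) (hk : 0 < k) {X Y U : M.cocircuits}
    (hY : M.cocircuitGraph.Adj X Y) (hU : M.cocircuitGraph.Adj (-X) U)
    (hYU : 1 < (Y.1.zeros \ U.1.zeros).card) :
    M.cocircuitGraph.dist Y U < M.cocircuitGraph.dist Y (-Y) := by
  have hY1 := h.adj_iff.1 hY
  have hU1 := h.adj_iff.1 hU
  rw [coe_neg_cocircuit, zeros_neg] at hU1
  obtain ⟨e, he⟩ := Finset.card_eq_one.1 hY1.1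
  obtain ⟨g, hg⟩ := Finset.card_eq_one.1 ((h.card_sdiff_comm Y X).trans hY1.1)
  have heX : e ∈ X.1.zeros ∧ e ∉ Y.1.zeros := Finset.mem_sdiff.1 (he ▸ Finset.mem_singleton_self e)
  have hgX : g ∈ Y.1.zeros ∧ g ∉ X.1.zeros := Finset.mem_sdiff.1 (hg ▸ Finset.mem_singleton_self g)
  have hXY : ∀ f ∈ X.1.zeros, f ≠ e → f ∈ Y.1.zeros := fun f hf hfe => by
    by_contra hc
    exact hfe (Finset.mem_singleton.1 (he ▸ Finset.mem_sdiff.2 ⟨hf, hc⟩))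
  have hYX : ∀ f ∈ Y.1.zeros, f ≠ g → f ∈ X.1.zeros := fun f hf hfg => by
    by_contra hc
    exact hfg (Finset.mem_singleton.1 (hg ▸ Finset.mem_sdiff.2 ⟨hf, hc⟩))
  have hsub : Y.1.zeros \ U.1.zeros ⊆ insert g (X.1.zeros \ U.1.zeros) := by
    intro f hf
    rw [Finset.mem_sdiff] at hf
    rw [Finset.mem_insert, Finset.mem_sdiff]
    by_cases hfg : f = g
    · exact Or.inl hfg
    · exact Or.inr ⟨hYX f hf.1 hfg, hf.2⟩
  have hgU : g ∉ U.1.zeros := by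
    intro hgU
    have h1 : Y.1.zeros \ U.1.zeros ⊆ X.1.zeros \ U.1.zeros := by
      intro f hf
      refine (Finset.mem_insert.1 (hsub hf)).resolve_left ?_
      rintro rfl
      exact (Finset.mem_sdiff.1 hf).2 hgU
    have := Finset.card_le_card h1
    omega
  have heU : e ∈ U.1.zeros := by
    by_contra heU
    have h1 : X.1.zeros \ U.1.zeros = {e} :=
      (Finset.eq_of_subset_of_card_le (Finset.singleton_subset_iff.2
        (Finset.mem_sdiff.2 ⟨heX.1, heU⟩)) (by rw [hU1.1]; simp)).symm
    have h2 : Y.1.zeros \ U.1.zeros ⊆ {g} := by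
      intro f hf
      rcases Finset.mem_insert.1 (hsub hf) with rfl | hf'
      · simp
      · rw [h1, Finset.mem_singleton] at hf'
        rw [hf', Finset.mem_sdiff] at hf
        exact absurd hf.1 heX.2
    have := Finset.card_le_card h2
    rw [Finset.card_singleton] at this
    omega
  have hgX0 : X.1 g ≠ 0 := by simpa using hgX.2
  have hgU0 : U.1 g ≠ 0 := by simpa using hgU
  -- the line through `X` and `U` meets the hyperplane `g` in `P`, between `X` and `U`
  have hUg : U.1 g = -X.1 g :=
    eq_of_notMem_sep (X := (-X : M.cocircuits).1) (by rw [(h.adj_iff.1 hU).2]; simp)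
      (by simpa using hgX0) hgU0
  obtain ⟨P, hP, hP1, hP2, hP3⟩ := h.exists_between_card (X := X) (Y := U) hU1.1 (f := g)
    (mem_sep.2 ⟨by rw [hUg, neg_neg], hgX0⟩)
  have hPg : P.1 g = 0 := by rw [← mem_zeros, hP]; exact Finset.mem_insert_self _ _
  have hPe : P.1 e = 0 := by
    rw [← mem_zeros, hP]
    exact Finset.mem_insert_of_mem (Finset.mem_inter.2 ⟨heX.1, heU⟩)
  have hYP1 : (Y.1.zeros \ P.1.zeros).card ≤ 1 := by
    rw [← hP1]
    refine Finset.card_le_card fun f hf => ?_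
    rw [Finset.mem_sdiff] at hf
    refine Finset.mem_sdiff.2 ⟨hYX f hf.1 ?_, hf.2⟩
    rintro rfl
    exact hf.2 (by simpa using hPg)
  have hYP : (Y.1.zeros \ P.1.zeros).card = 1 := by
    refine le_antisymm hYP1 (Nat.pos_of_ne_zero fun h0 => ?_)
    refine heX.2 ?_
    rw [h.eq_of_card_sdiff_eq_zero h0]
    simpa using hPe
  have hmoved : Y.1.moved P.1 ⊆ insert e ((X.1.moved P.1).erase g) := by
    intro f hf
    rw [mem_moved] at hf
    rw [Finset.mem_insert, Finset.mem_erase, mem_moved]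
    by_cases hfe : f = e
    · exact Or.inl hfe
    · have hfX : X.1 f ≠ 0 := fun hc =>
        hf.1 (mem_zeros.1 (hXY f (mem_zeros.2 hc) hfe))
      have h1 : Y.1 f = X.1 f := eq_of_notMem_sep (by rw [hY1.2]; simp) hfX hf.1
      refine Or.inr ⟨?_, hfX, h1 ▸ hf.2⟩
      rintro rfl
      exact hf.1 (mem_zeros.1 hgX.1)
  have hle : (Y.1.moved P.1).card ≤ (X.1.moved P.1).card := by
    have hgm : g ∈ X.1.moved P.1 := mem_moved.2 ⟨hgX0, by rw [hPg]; exact hgX0.symm⟩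
    have h1 := Finset.card_le_card hmoved
    have h2 := Finset.card_insert_le e ((X.1.moved P.1).erase g)
    have h3 := Finset.card_erase_add_one hgm
    omega
  have h1 := (h.connected hk).dist_triangle (u := Y) (v := P) (w := U)
  rw [h.dist_of_collinear hk hYP, h.dist_of_collinear hk hP2] at h1
  have h2 := h.dist_add_dist_neg hk hU1.1
  rw [h.dist_of_collinear hk hU1.1, SimpleGraph.dist_comm,
    SimpleGraph.dist_eq_one_iff_adj.2 hU] at h2
  have h3 := h.dist_neg hk Y
  omega

/-- The antipodal map is the only involutive automorphism of the cocircuit graph commuting with it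
that moves every cocircuit at least as far as the antipodal map does. The two agree at a cocircuit
whose zero set is moved by at most one exchange, and agreement spreads along edges. -/
theorem eq_neg_of_involutive (h : M.IsGeneric k) (hk : 0 < k)
    (m : M.cocircuitGraph ≃g M.cocircuitGraph) (hm : ∀ X, m (m X) = X) (hneg : ∀ X, m (-X) = -m X)
    (hd : ∀ X, M.cocircuitGraph.dist X (-X) ≤ M.cocircuitGraph.dist X (m X)) (X : M.cocircuits) :
    m X = -X := by
  obtain ⟨φ, hφ⟩ := h.exists_equiv_of_antipodal h hk hk m hneg
  have hφφ : ∀ e, φ (φ e) = e := by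
    intro e
    by_contra hne
    obtain ⟨B, hB, hBA, hBk⟩ : ∃ B : Finset E, e ∈ B ∧ φ (φ e) ∉ B ∧ B.card = k := by
      obtain ⟨B, hB, hB', hBk⟩ := Finset.exists_subsuperset_card_eq
        (s := {e}) (t := Finset.univ.erase (φ (φ e))) (n := k)
        (by simpa using Ne.symm hne) (by rw [Finset.card_singleton]; exact hk)
        (by rw [Finset.card_erase_of_mem (Finset.mem_univ _), Finset.card_univ]
            have := h.lt_card; omega)
      exact ⟨B, hB (Finset.mem_singleton_self e),
        fun hc => (Finset.mem_erase.1 (hB' hc)).1 rfl, hBk⟩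
    obtain ⟨Y, rfl⟩ := h.exists_cocircuit_zeros' hBk
    rw [hφ, hφ, hm] at hB
    exact hBA hB
  obtain ⟨A, hA, hA1⟩ := exists_card_sdiff_map_le_one φ hφφ k h.lt_card.le
  obtain ⟨Z, rfl⟩ := h.exists_cocircuit_zeros' hA
  have hZ : m Z = -Z := by
    refine h.eq_neg_of_dist_neg_le_dist hk
      (le_trans (Finset.card_le_card fun e he => ?_) hA1) (hd Z)
    rw [Finset.mem_sdiff] at he
    refine Finset.mem_filter.2 ⟨he.1, fun hc => he.2 ?_⟩
    have := (hφ Z (φ e)).1 hc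
    rwa [hφφ] at this
  clear hA hA1
  obtain ⟨p⟩ := (h.connected hk).preconnected Z X
  induction p with
  | nil => exact hZ
  | @cons X Y _ hadj p ih =>
    refine ih ?_
    have hU : M.cocircuitGraph.Adj (-X) (m Y) := by
      rw [← hZ]; exact m.map_adj_iff.2 hadj
    by_contra hne
    refine absurd (hd Y) (not_le.2 (h.dist_lt_of_adj_of_adj_neg hk hadj hU ?_))
    by_contra hle
    exact hne (h.eq_neg_of_dist_neg_le_dist hk (not_lt.1 hle) (hd Y))

end IsGeneric

end OrientedMatroid

/-! ### Isomorphisms compatible with the antipodal maps -/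

section Involutions

/-- Two involutions `μ`, `ν` in a finite group are conjugate by a power of `μ * ν`, provided `ν` is
the only conjugate of `μ` or `ν` that commutes with `ν`. In other words, the dihedral group they
generate has rotation subgroup of odd order: otherwise the half turn times `ν` would be another such
conjugate. -/
theorem exists_conj_of_involutions {G : Type*} [Group G] [Finite G] {μ ν : G} (hμ : μ * μ = 1)
    (hν : ν * ν = 1)
    (h : ∀ σ g : G, (σ = g * ν * g⁻¹ ∨ σ = g * μ * g⁻¹) → σ * ν = ν * σ → σ = ν) :
    ∃ i : ℕ, (μ * ν) ^ i * ν * ((μ * ν) ^ i)⁻¹ = μ := by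
  have hν' : ν⁻¹ = ν := inv_eq_of_mul_eq_one_left hν
  have hμ' : μ⁻¹ = μ := inv_eq_of_mul_eq_one_left hμ
  have hconj : ∀ i : ℕ, ν * ((μ * ν) ^ i)⁻¹ = (μ * ν) ^ i * ν := by
    intro i
    have h1 : ν * (μ * ν)⁻¹ * ν⁻¹ = μ * ν := by
      rw [mul_inv_rev, hν', hμ', ← mul_assoc, hν, one_mul]
    rw [← inv_pow, eq_comm, ← eq_mul_inv_iff_mul_eq, ← conj_pow, h1]
  have hνc : ∀ i : ℕ, (μ * ν) ^ i * ν * ((μ * ν) ^ i)⁻¹ = (μ * ν) ^ (2 * i) * ν := by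
    intro i
    rw [mul_assoc, hconj, ← mul_assoc, ← pow_add, two_mul]
  have hμc : ∀ i : ℕ, (μ * ν) ^ i * μ * ((μ * ν) ^ i)⁻¹ = (μ * ν) ^ (2 * i + 1) * ν := by
    intro i
    calc (μ * ν) ^ i * μ * ((μ * ν) ^ i)⁻¹
        = (μ * ν) ^ i * (μ * (ν * ν)) * ((μ * ν) ^ i)⁻¹ := by rw [hν, mul_one]
      _ = (μ * ν) ^ i * (μ * ν) * (ν * ((μ * ν) ^ i)⁻¹) := by simp only [mul_assoc]
      _ = (μ * ν) ^ (2 * i + 1) * ν := by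
        rw [hconj, ← pow_succ, ← mul_assoc, ← pow_add]
        congr 2
        omega
  have hpos := orderOf_pos (μ * ν)
  rcases Nat.even_or_odd' (orderOf (μ * ν)) with ⟨q, hq | hq⟩
  · exfalso
    have hσ : (μ * ν) ^ q * ν = ν := by
      obtain ⟨i, hi⟩ : ∃ i, q = 2 * i ∨ q = 2 * i + 1 :=
        (Nat.even_or_odd' q)
      refine h _ ((μ * ν) ^ i) ?_ ?_
      · rcases hi with rfl | rfl
        · exact Or.inl (hνc i).symm
        · exact Or.inr (hμc i).symm
      · have hinv : (μ * ν) ^ q = ((μ * ν) ^ q)⁻¹ := by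
          rw [eq_inv_iff_mul_eq_one, ← pow_add, ← two_mul, ← hq, pow_orderOf_eq_one]
        calc (μ * ν) ^ q * ν * ν = (μ * ν) ^ q := by rw [mul_assoc, hν, mul_one]
          _ = ν * (ν * ((μ * ν) ^ q)⁻¹) := by rw [← mul_assoc, hν, one_mul, ← hinv]
          _ = ν * ((μ * ν) ^ q * ν) := by rw [hconj]
    rw [mul_eq_right] at hσ
    have := orderOf_dvd_of_pow_eq_one hσ
    have := Nat.le_of_dvd (by omega) this
    omega
  · refine ⟨q + 1, ?_⟩
    rw [hνc, show 2 * (q + 1) = orderOf (μ * ν) + 1 by omega, pow_succ, pow_orderOf_eq_one, one_mul,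
      mul_assoc, hν, mul_one]

end Involutions

namespace OrientedMatroid

open SignVec

variable {E F : Type*} {M : OrientedMatroid E} {N : OrientedMatroid F} {k l : ℕ}

theorem sep_neg_neg (X Y : SignVec E) : (-X).sep (-Y) = X.sep Y := by
  ext e
  rw [mem_sep, mem_sep, Pi.neg_apply, Pi.neg_apply]
  generalize X e = x
  generalize Y e = y
  revert x y
  decide

/-- A relabeling of cocircuits is a relabeling of covectors, since covectors are the conformal
compositions of cocircuits. -/
theorem IsGeneric.relabelingEquiv [Fintype E] [Fintype F] (hM : M.IsGeneric k)
    (hN : N.IsGeneric l) {φ : E ≃ F} (f : M.cocircuitGraph ≃g N.cocircuitGraph)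
    (hf : ∀ X, (f X).1 = mapSign φ X.1) :
    M.RelabelingEquiv N := by
  refine ⟨φ, fun X => ⟨fun hX => ?_, fun hX => ?_⟩⟩
  · refine mem_covectors_of_conf N fun p hp => ?_
    obtain ⟨Y, hY, hYX, hYe⟩ := hM.exists_cocircuit_conf hX (e := φ.symm p) hp
    refine ⟨(f ⟨Y, hY⟩).1, (f ⟨Y, hY⟩).2.1, ?_, ?_⟩
    · rw [hf]; exact fun q => hYX (φ.symm q)
    · rw [hf]; exact hYe
  · refine mem_covectors_of_conf M fun e he => ?_
    obtain ⟨Y, hY, hYX, hYe⟩ := hN.exists_cocircuit_conf hX (e := φ e) (by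
      rwa [mapSign, Equiv.symm_apply_apply])
    obtain ⟨Z, hZ⟩ := f.surjective ⟨Y, hY⟩
    have hZY : Y = mapSign φ Z.1 := by rw [← hf, hZ]
    have h1 : ∀ g, Z.1 g = Y (φ g) := fun g => by rw [hZY, mapSign, Equiv.symm_apply_apply]
    have h2 : ∀ g, X g = mapSign φ X (φ g) := fun g => by rw [mapSign, Equiv.symm_apply_apply]
    refine ⟨Z.1, Z.2.1, fun g => ?_, ?_⟩
    · rw [h1, h2]; exact hYX (φ g)
    · rw [h1, h2, hYe]

variable [Fintype E] [DecidableEq E] [Fintype F] [DecidableEq F]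

theorem IsGeneric.adj_neg_neg (h : M.IsGeneric k) (X Y : M.cocircuits) :
    M.cocircuitGraph.Adj (-X) (-Y) ↔ M.cocircuitGraph.Adj X Y := by
  rw [h.adj_iff, h.adj_iff, coe_neg_cocircuit, coe_neg_cocircuit, zeros_neg, zeros_neg,
    sep_neg_neg]

/-- The antipodal map as an automorphism of the cocircuit graph. -/
def IsGeneric.antipode (h : M.IsGeneric k) : M.cocircuitGraph ≃g M.cocircuitGraph where
  toEquiv := Equiv.neg M.cocircuits
  map_rel_iff' := h.adj_neg_neg _ _

/-- The antipodal map of `N`, followed by the antipodal map of `M` transported along `f`. -/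
def antipodeMul (hM : M.IsGeneric k) (hN : N.IsGeneric l)
    (f : M.cocircuitGraph ≃g N.cocircuitGraph) : N.cocircuitGraph ≃g N.cocircuitGraph :=
  ((f.symm.trans hM.antipode).trans f) * hN.antipode

/-- An isomorphism of cocircuit graphs, not necessarily compatible with the antipodal maps, becomes
so after composition with a power of `antipodeMul`. The hypothesis on the cardinalities says that
antipodes are at least as far apart in `M` as in `N`. -/
theorem IsGeneric.exists_antipodal_of_le (hM : M.IsGeneric k) (hN : N.IsGeneric l) (hk : 0 < k)
    (hl : 0 < l) (f : M.cocircuitGraph ≃g N.cocircuitGraph)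
    (hle : Fintype.card F + k ≤ Fintype.card E + l) :
    ∃ i : ℕ, ∀ X, (antipodeMul hM hN f ^ i)⁻¹ (f (-X)) = -(antipodeMul hM hN f ^ i)⁻¹ (f X) := by
  set ν := hN.antipode
  set μ : N.cocircuitGraph ≃g N.cocircuitGraph := (f.symm.trans hM.antipode).trans f
  have hμa : ∀ X, μ X = f (-f.symm X) := fun X => rfl
  have hνa : ∀ X, ν X = -X := fun X => rfl
  have hμμ : μ * μ = 1 := by ext1 X; simp [RelIso.mul_apply, hμa]
  have hνν : ν * ν = 1 := by ext1 X; simp [RelIso.mul_apply, hνa]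
  have : Finite (N.cocircuitGraph ≃g N.cocircuitGraph) :=
    Finite.of_injective (fun t => (t : N.cocircuits → N.cocircuits)) DFunLike.coe_injective
  have hdN := (hN.connected hl).dist_iso (hN.connected hl)
  have hdM := (hM.connected hk).dist_iso (hN.connected hl) f
  obtain ⟨i, hi⟩ := exists_conj_of_involutions hμμ hνν fun σ g hσ hc => by
    have hσσ : σ * σ = 1 := by
      rcases hσ with rfl | rfl
      · rw [conj_mul, hνν, mul_one, mul_inv_cancel]
      · rw [conj_mul, hμμ, mul_one, mul_inv_cancel]
    ext1 X
    refine hN.eq_neg_of_involutive hl σ (fun X => DFunLike.congr_fun hσσ X)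
      (fun X => DFunLike.congr_fun hc X) (fun X => ?_) X
    obtain ⟨Y, rfl⟩ := g.surjective X
    rcases hσ with rfl | rfl
    · have h1 : (g * ν * g⁻¹) (g Y) = g (-Y) := by
        simp [RelIso.mul_apply, hνa]
      rw [h1, hdN g, hN.dist_neg_eq hl _ Y]
    · have h1 : (g * μ * g⁻¹) (g Y) = g (f (-f.symm Y)) := by
        simp [RelIso.mul_apply, hμa]
      obtain ⟨Z, rfl⟩ := f.surjective Y
      rw [h1, hdN g, RelIso.symm_apply_apply, hdM]
      have h2 := hM.dist_neg hk Z
      have h3 := hN.dist_neg hl (g (f Z))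
      omega
  refine ⟨i, fun X => ?_⟩
  change ((μ * ν) ^ i)⁻¹ (f (-X)) = -((μ * ν) ^ i)⁻¹ (f X)
  have h1 : (μ * ν) ^ i * ν = μ * (μ * ν) ^ i := mul_inv_eq_iff_eq_mul.1 hi
  have h2 := DFunLike.congr_fun h1 (((μ * ν) ^ i)⁻¹ (f X))
  rw [RelIso.mul_apply, RelIso.mul_apply, RelIso.apply_inv_self, hμa, RelIso.symm_apply_apply,
    hνa] at h2
  rw [← h2, RelIso.inv_apply_self]

/-- Whether two cocircuits, one exchange apart, have opposite signs at `e` is visible in the metric: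
a shortest path between them can then pass through the hyperplane of `e`. -/
theorem IsGeneric.eq_neg_iff (h : M.IsGeneric k) (hk : 0 < k) {X Y : M.cocircuits}
    (hXY : (X.1.zeros \ Y.1.zeros).card = 1) {e : E} (hX : X.1 e ≠ 0) (hY : Y.1 e ≠ 0) :
    X.1 e = -Y.1 e ↔ ∃ P : M.cocircuits, e ∈ P.1.zeros ∧
      M.cocircuitGraph.dist X P + M.cocircuitGraph.dist P Y ≤ M.cocircuitGraph.dist X Y := by
  constructor
  · intro heq
    obtain ⟨P, hP, hP1, hP2, hP3⟩ := h.exists_between_card hXY (mem_sep.2 ⟨heq, hX⟩)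
    refine ⟨P, hP ▸ Finset.mem_insert_self _ _, ?_⟩
    rw [h.dist_of_collinear hk hP1, h.dist_of_collinear hk hP2, hP3, h.dist_of_collinear hk hXY]
  · rintro ⟨P, hP, hle⟩
    by_contra hne
    have heq : Y.1 e = X.1 e :=
      (eq_or_eq_neg_of_ne_zero hX hY).resolve_right fun hc => hne (by rw [hc, neg_neg])
    rw [mem_zeros] at hP
    have hsub : insert e (X.1.moved Y.1) ⊆ X.1.moved P.1 ∪ P.1.moved Y.1 := by
      refine Finset.insert_subset (Finset.mem_union_left _ (mem_moved.2 ⟨hX, ?_⟩)) ?_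
      · rw [hP]; exact hX.symm
      · exact moved_subset _ _ _
    have h1 := Finset.card_le_card hsub
    rw [Finset.card_insert_of_notMem fun hc => (mem_moved.1 hc).2 heq] at h1
    have h2 := Finset.card_union_le (X.1.moved P.1) (P.1.moved Y.1)
    have h3 := h.card_moved_le_dist hk X P
    have h4 := h.card_moved_le_dist hk P Y
    rw [h.dist_of_collinear hk hXY] at hle
    omega

/-- An isomorphism of cocircuit graphs that commutes with the antipodal maps and respects
non-negativity relabels cocircuits, if `M` is acyclic. -/
theorem IsGeneric.exists_mapSign_eq (hM : M.IsGeneric k) (hN : N.IsGeneric l) (hk : 0 < k)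
    (hl : 0 < l) (hacyc : M.IsAcyclic) (f : M.cocircuitGraph ≃g N.cocircuitGraph)
    (hf : ∀ X, f (-X) = -f X)
    (hpos : ∀ X : M.cocircuits, (∀ e, 0 ≤ X.1 e) → ∀ e, 0 ≤ (f X).1 e) :
    ∃ φ : E ≃ F, ∀ X, (f X).1 = mapSign φ X.1 := by
  obtain ⟨φ, hφ⟩ := hM.exists_equiv_of_antipodal hN hk hl f hf
  have hcard : ∀ X Y : M.cocircuits,
      ((f X).1.zeros \ (f Y).1.zeros).card = (X.1.zeros \ Y.1.zeros).card := by
    intro X Y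
    rw [← Finset.card_map φ.toEmbedding]
    congr 1
    ext p
    obtain ⟨e, rfl⟩ := φ.surjective p
    simp only [Finset.mem_sdiff, ← hφ, Finset.mem_map_equiv, Equiv.symm_apply_apply]
  have hd := (hM.connected hk).dist_iso (hN.connected hl) f
  have hne : ∀ X e, X.1 e ≠ 0 ↔ (f X).1 (φ e) ≠ 0 := fun X e => by
    rw [Ne, ← mem_zeros, hφ, mem_zeros]
  have hsign : ∀ X Y e, (X.1.zeros \ Y.1.zeros).card = 1 → X.1 e ≠ 0 → Y.1 e ≠ 0 →
      (X.1 e = -Y.1 e ↔ (f X).1 (φ e) = -(f Y).1 (φ e)) := by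
    intro X Y e hXY hX hY
    rw [hM.eq_neg_iff hk hXY hX hY, hN.eq_neg_iff hl ((hcard X Y).trans hXY) ((hne X e).1 hX)
      ((hne Y e).1 hY), ← f.toEquiv.exists_congr_right]
    refine exists_congr fun P => ?_
    change _ ↔ φ e ∈ (f P).1.zeros ∧ N.cocircuitGraph.dist (f X) (f P) +
      N.cocircuitGraph.dist (f P) (f Y) ≤ N.cocircuitGraph.dist (f X) (f Y)
    rw [hd, hd, hd, hφ]
  -- induction on the distance of the zero set of `X` from that of a cocircuit positive at `e`,
  -- through `k`-sets that avoid `e`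
  have key : ∀ e X, X.1 e ≠ 0 → (f X).1 (φ e) = X.1 e := by
    intro e
    obtain ⟨X0, hX0, hX0c, hX0e⟩ := hM.exists_cocircuit_conf hacyc (e := e) one_ne_zero
    have h0 : (f ⟨X0, hX0⟩).1 (φ e) = X0 e := by
      have h1 := hpos ⟨X0, hX0⟩ (fun g => by
        rcases hX0c g with h | h <;> simp [h]) (φ e)
      have h2 := (hne ⟨X0, hX0⟩ e).1 (by simp [hX0e])
      rw [hX0e]
      revert h1 h2
      generalize (f ⟨X0, hX0⟩).1 (φ e) = x
      revert x
      decide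
    intro X hX
    induction hn : (X.1.zeros \ X0.zeros).card generalizing X with
    | zero =>
      rcases hM.cocircuit_eq_or_eq_neg
        (hM.eq_of_card_sdiff_eq_zero (X := X) (Y := ⟨X0, hX0⟩) hn).symm with rfl | rfl
      · exact h0
      · rw [hf, coe_neg_cocircuit, coe_neg_cocircuit, Pi.neg_apply, Pi.neg_apply, h0]
    | succ n ih =>
      obtain ⟨a, ha⟩ : (X.1.zeros \ X0.zeros).Nonempty := Finset.card_pos.1 (by omega)
      obtain ⟨b, hb⟩ : (X0.zeros \ X.1.zeros).Nonempty := Finset.card_pos.1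
        ((hn ▸ Nat.succ_pos n : 0 < (X.1.zeros \ X0.zeros).card).trans_eq
          (hM.card_sdiff_comm X ⟨X0, hX0⟩))
      rw [Finset.mem_sdiff] at ha hb
      obtain ⟨Y, hY⟩ := hM.exists_cocircuit_zeros' (A := insert b (X.1.zeros.erase a)) (by
        rw [Finset.card_insert_of_notMem (fun hc => hb.2 (Finset.mem_of_mem_erase hc)),
          Finset.card_erase_add_one ha.1, hM.card_zeros])
      have hXY : (X.1.zeros \ Y.1.zeros).card = 1 := by
        rw [Finset.card_eq_one]
        refine ⟨a, sdiff_eq_singleton_of_erase_subset ha.1 ?_ ?_⟩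
        · rw [hY, Finset.mem_insert, not_or]
          exact ⟨by rintro rfl; exact hb.2 ha.1, Finset.notMem_erase _ _⟩
        · rw [hY]; exact Finset.subset_insert _ _
      have hYX0 : Y.1.zeros \ X0.zeros = (X.1.zeros \ X0.zeros).erase a := by
        rw [hY, Finset.insert_sdiff_of_mem _ hb.1, Finset.erase_sdiff_comm]
      have hYe : Y.1 e ≠ 0 := by
        rw [Ne, ← mem_zeros, hY, Finset.mem_insert, not_or]
        refine ⟨?_, fun hc => hX (mem_zeros.1 (Finset.mem_of_mem_erase hc))⟩
        rintro rfl
        rw [mem_zeros, hX0e] at hb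
        exact one_ne_zero hb.1
      have h1 := ih Y hYe (by
        rw [hYX0, Finset.card_erase_of_mem (Finset.mem_sdiff.2 ha), hn, Nat.add_sub_cancel])
      have h2 := hsign X Y e hXY hX hYe
      have h3 := (hne X e).1 hX
      rw [h1] at h2
      revert h2 h3 hX hYe
      generalize (f X).1 (φ e) = x
      generalize X.1 e = y
      generalize Y.1 e = z
      revert x y z
      decide
  refine ⟨φ, fun X => funext fun p => ?_⟩
  obtain ⟨e, rfl⟩ := φ.surjective p
  rw [mapSign, Equiv.symm_apply_apply]
  by_cases hX : X.1 e = 0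
  · rw [hX]
    by_contra hc
    exact (hne X e).2 hc hX
  · exact key e X hX

end OrientedMatroid

/-! ### Degrees and common neighbours in `G(M)` -/

namespace OrientedMatroid

open SignVec

variable {E F : Type*} {M : OrientedMatroid E} {N : OrientedMatroid F} {k l : ℕ}

instance [Finite E] : Finite (GVertex M) :=
  Finite.of_surjective
    (Sum.elim GVertex.cocircuit fun b : Bool => cond b GVertex.vplus GVertex.vminus) <| by
      rintro (X | _ | _)
      · exact ⟨Sum.inl X, rfl⟩
      · exact ⟨Sum.inr true, rfl⟩
      · exact ⟨Sum.inr false, rfl⟩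

theorem not_nonpos_of_nonneg {X : M.cocircuits} (hX : ∀ e, 0 ≤ X.1 e) : ¬∀ e, X.1 e ≤ 0 :=
  fun h => X.2.2.1 (funext fun e => le_antisymm (h e) (hX e))

/-- The vertices `v₊` and `v₋` are not adjacent, so a triangle of `G(M)` contains an edge of the
cocircuit graph. -/
theorem exists_adj_of_triangle {a b c : GVertex M} (hab : M.G.Adj a b) (hac : M.G.Adj a c)
    (hbc : M.G.Adj b c) : ∃ X Y : M.cocircuits, M.cocircuitGraph.Adj X Y := by
  rcases a with X | _ | _ <;> rcases b with Y | _ | _ <;> rcases c with Z | _ | _ <;>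
    first
    | exact ⟨X, Y, hab⟩
    | exact ⟨X, Z, hac⟩
    | exact ⟨Y, Z, hbc⟩
    | exact hab.elim
    | exact hac.elim
    | exact hbc.elim

theorem IsUniform.exists_rank_eq [Finite E] (hM : M.IsUniform) (X : M.cocircuits) :
    ∃ k : ℕ, M.rank = (k + 1 : ℕ) := by
  obtain ⟨e, he⟩ := exists_ne_zero X.2.2.1
  have hind : M.underlying.Indep {e} := by
    rw [underlying_indep]
    rintro a rfl hc
    exact he (hc X.1 X.2.1 (by simp))
  have h1 := (hM _).1 hind
  rw [Set.encard_singleton] at h1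
  have h2 : M.rank ≠ ⊤ := by
    refine ne_top_of_le_ne_top ?_ (Matroid.eRank_le_encard_ground M.underlying)
    exact Set.encard_ne_top_iff.2 (Set.toFinite _)
  obtain ⟨r, hr⟩ := ENat.ne_top_iff_exists.1 h2
  rw [← hr] at h1 ⊢
  have h3 : 1 ≤ r := by exact_mod_cast h1
  exact ⟨r - 1, by rw [Nat.sub_add_cancel h3]⟩

namespace IsGeneric

variable [Fintype E] [DecidableEq E] [Fintype F] [DecidableEq F]

theorem pos_of_adj (h : M.IsGeneric k) {X Y : M.cocircuits} (hXY : M.cocircuitGraph.Adj X Y) :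
    0 < k := by
  have h1 := Finset.card_le_card (Finset.sdiff_subset : X.1.zeros \ Y.1.zeros ⊆ X.1.zeros)
  rw [(h.adj_iff.1 hXY).1, h.card_zeros] at h1
  exact h1

/-- The automorphism of `G(M)` that negates cocircuits and exchanges `v₊` and `v₋`. -/
def flip (h : M.IsGeneric k) : M.G ≃g M.G where
  toFun
    | .cocircuit X => .cocircuit (-X)
    | .vplus => .vminus
    | .vminus => .vplus
  invFun
    | .cocircuit X => .cocircuit (-X)
    | .vplus => .vminus
    | .vminus => .vplus
  left_inv := by rintro (X | _ | _) <;> simp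
  right_inv := by rintro (X | _ | _) <;> simp
  map_rel_iff' := by
    have hneg : ∀ x : SignType, 0 ≤ -x ↔ x ≤ 0 := by decide
    have hneg' : ∀ x : SignType, -x ≤ 0 ↔ 0 ≤ x := by decide
    rintro (X | _ | _) (Y | _ | _)
    · exact h.adj_neg_neg X Y
    · exact forall_congr' fun e => hneg' _
    · exact forall_congr' fun e => hneg _
    · exact forall_congr' fun e => hneg' _
    · exact Iff.rfl
    · exact Iff.rfl
    · exact forall_congr' fun e => hneg _
    · exact Iff.rfl
    · exact Iff.rfl

/-- A cocircuit has one neighbour for each element of its zero set and each sign. -/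
theorem ncard_neighborSet (h : M.IsGeneric k) (X : M.cocircuits) :
    (M.cocircuitGraph.neighborSet X).ncard = 2 * k := by
  have hex : ∀ p ∈ ((X.1.zeros ×ˢ {1, -1} : Finset (E × SignType)) : Set (E × SignType)),
      ∃ Y : M.cocircuits, X.1.zeros \ Y.1.zeros = {p.1} ∧ Y.1 p.1 = p.2 ∧ X.1.sep Y.1 = ∅ := by
    rintro ⟨e, s⟩ hp
    simp only [Finset.coe_product, Set.mem_prod, Finset.mem_coe] at hp
    refine h.exists_neighbor X hp.1 ?_
    rintro rfl
    simp at hp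
  choose g hg1 hg2 hg3 using hex
  have hc : (X.1.zeros ×ˢ {1, -1} : Finset (E × SignType)).card = 2 * k := by
    rw [Finset.card_product, h.card_zeros, mul_comm]; rfl
  rw [← hc, ← Set.ncard_coe_finset, eq_comm]
  refine Set.ncard_congr g (fun p hp => ?_) (fun p q hp hq hpq => ?_) (fun Y hY => ?_)
  · exact h.adj_iff.2 ⟨by rw [hg1 p hp]; simp, hg3 p hp⟩
  · have h1 := hg1 p hp
    rw [hpq, hg1 q hq, Finset.singleton_inj] at h1
    have h2 := hg2 p hp
    rw [hpq, ← h1, hg2 q hq] at h2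
    exact Prod.ext h1.symm h2.symm
  · have hY' := h.adj_iff.1 hY
    obtain ⟨e, he⟩ := Finset.card_eq_one.1 hY'.1
    have heX := Finset.mem_sdiff.1 (he ▸ Finset.mem_singleton_self e : e ∈ X.1.zeros \ Y.1.zeros)
    have hYe : Y.1 e ≠ 0 := by simpa using heX.2
    have hp : (e, Y.1 e) ∈
        ((X.1.zeros ×ˢ {1, -1} : Finset (E × SignType)) : Set (E × SignType)) := by
      simp only [Finset.coe_product, Set.mem_prod, Finset.mem_coe]
      refine ⟨heX.1, ?_⟩
      revert hYe
      generalize Y.1 e = s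
      revert s
      decide
    exact ⟨_, hp, neighbor_unique hY (hg3 _ hp) (hg1 _ hp) (hg2 _ hp)⟩

theorem ncard_G_neighborSet_le (h : M.IsGeneric k) {X : M.cocircuits} (hX : ∀ e, 0 ≤ X.1 e) :
    (M.G.neighborSet (.cocircuit X)).ncard ≤ 2 * k + 1 := by
  have hsub : M.G.neighborSet (.cocircuit X) ⊆
      insert .vplus (GVertex.cocircuit '' M.cocircuitGraph.neighborSet X) := by
    rintro (Y | _ | _) hY
    · exact Or.inr ⟨Y, hY, rfl⟩
    · exact Or.inl rfl
    · exact absurd hY (not_nonpos_of_nonneg hX)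
  refine (Set.ncard_le_ncard hsub (Set.toFinite _)).trans ((Set.ncard_insert_le _ _).trans ?_)
  rw [← h.ncard_neighborSet X]
  exact Nat.add_le_add_right (Set.ncard_image_le (Set.toFinite _)) 1

theorem le_ncard_G_neighborSet (h : M.IsGeneric k) (X : M.cocircuits) :
    2 * k ≤ (M.G.neighborSet (.cocircuit X)).ncard := by
  rw [← h.ncard_neighborSet X]
  refine Set.ncard_le_ncard_of_injOn GVertex.cocircuit (fun Y hY => hY) ?_ (Set.toFinite _)
  intro Y _ Z _ hYZ
  exact GVertex.cocircuit.inj hYZ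

/-- Entering a positive sign at an element of the zero set leads from a non-negative cocircuit to a
non-negative one. -/
theorem le_ncard_commonNeighbors (h : M.IsGeneric k) {X : M.cocircuits} (hX : ∀ e, 0 ≤ X.1 e) :
    k ≤ (M.G.commonNeighbors .vplus (.cocircuit X)).ncard := by
  have hex : ∀ e, ∃ Y : M.cocircuits, e ∈ X.1.zeros →
      X.1.zeros \ Y.1.zeros = {e} ∧ Y.1 e = 1 ∧ X.1.sep Y.1 = ∅ := by
    intro e
    by_cases he : e ∈ X.1.zeros
    · obtain ⟨Y, hY⟩ := h.exists_neighbor X he (one_ne_zero (α := SignType))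
      exact ⟨Y, fun _ => hY⟩
    · exact ⟨X, fun hc => absurd hc he⟩
  choose g hg using hex
  rw [← h.card_zeros X, ← Set.ncard_coe_finset]
  refine Set.ncard_le_ncard_of_injOn (fun e => GVertex.cocircuit (g e)) (fun e he => ⟨?_, ?_⟩) ?_
    (Set.toFinite _)
  · intro f
    obtain ⟨h1, h2, h3⟩ := hg e he
    by_cases hf0 : (g e).1 f = 0
    · rw [hf0]
    by_cases hfX : f ∈ X.1.zeros
    · have : f ∈ X.1.zeros \ (g e).1.zeros := Finset.mem_sdiff.2 ⟨hfX, by simpa using hf0⟩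
      rw [h1, Finset.mem_singleton] at this
      rw [this, h2]
      decide
    · rw [eq_of_notMem_sep (X := X.1) (by rw [h3]; simp) (by simpa using hfX) hf0]
      exact hX f
  · obtain ⟨h1, h2, h3⟩ := hg e he
    exact h.adj_iff.2 ⟨by rw [h1]; simp, h3⟩
  · intro e he f hf hef
    have h1 := (hg e he).1
    rw [GVertex.cocircuit.inj hef, (hg f hf).1, Finset.singleton_inj] at h1
    exact h1.symm

/-- Apart from the smallest possible ground sets, every cocircuit has a neighbour with which it
shares few neighbours in `G(M)`. -/
theorem exists_ncard_commonNeighbors_lt (h : M.IsGeneric k) (hk : 0 < k)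
    (hcard : k + 2 ≤ Fintype.card E) (X : M.cocircuits) :
    ∃ Y : M.cocircuits, M.cocircuitGraph.Adj X Y ∧
      (M.G.commonNeighbors (.cocircuit X) (.cocircuit Y)).ncard < k := by
  obtain ⟨e, he⟩ := Finset.card_pos.1 (by rw [h.card_zeros X]; exact hk)
  -- the sign at `e` is chosen such that `v₊` and `v₋` are not common neighbours
  obtain ⟨s, hs, hs1, hs2⟩ : ∃ s : SignType, s ≠ 0 ∧ ((∀ f, 0 ≤ X.1 f) → ¬0 ≤ s) ∧
      ((∀ f, X.1 f ≤ 0) → ¬s ≤ 0) := by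
    by_cases hX : ∀ f, 0 ≤ X.1 f
    · exact ⟨-1, by decide, fun _ => by decide, fun hc => absurd hc (not_nonpos_of_nonneg hX)⟩
    · exact ⟨1, by decide, fun hc => absurd hc hX, fun _ => by decide⟩
  obtain ⟨Y, hY1, hY2, hY3⟩ := h.exists_neighbor X he hs
  have hXY : M.cocircuitGraph.Adj X Y := h.adj_iff.2 ⟨by rw [hY1]; simp, hY3⟩
  refine ⟨Y, hXY, ?_⟩
  have heY : e ∉ Y.1.zeros := by rw [mem_zeros, hY2]; exact hs
  obtain ⟨g, hg⟩ := Finset.card_eq_one.1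
    ((h.card_sdiff_comm Y X).trans (by rw [hY1]; simp))
  have hgY := Finset.mem_sdiff.1 (hg ▸ Finset.mem_singleton_self g : g ∈ Y.1.zeros \ X.1.zeros)
  have hcommon : ∀ v ∈ M.G.commonNeighbors (.cocircuit X) (.cocircuit Y),
      ∃ Z : M.cocircuits, v = .cocircuit Z ∧ M.cocircuitGraph.Adj X Z ∧
        M.cocircuitGraph.Adj Y Z := by
    rintro (Z | _ | _) ⟨hZ1, hZ2⟩
    · exact ⟨Z, rfl, hZ1, hZ2⟩
    · exact absurd (hY2 ▸ hZ2 e) (hs1 hZ1)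
    · exact absurd (hY2 ▸ hZ2 e) (hs2 hZ1)
  have hex : ∀ v : GVertex M, ∃ a, ∀ Z : M.cocircuits, v = .cocircuit Z → M.cocircuitGraph.Adj X Z →
      M.cocircuitGraph.Adj Y Z → a ∈ X.1.zeros.erase e ∧
        Z.1.zeros = insert g (X.1.zeros.erase a) := by
    rintro (Z | _ | _)
    · by_cases hZ : M.cocircuitGraph.Adj X Z ∧ M.cocircuitGraph.Adj Y Z
      swap
      · exact ⟨e, by rintro _ ⟨⟩ h1 h2; exact absurd ⟨h1, h2⟩ hZ⟩
      have hXZ := h.adj_iff.1 hZ.1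
      have hYZ := h.adj_iff.1 hZ.2
      obtain ⟨a, ha⟩ := Finset.card_eq_one.1 hXZ.1
      have haX := Finset.mem_sdiff.1 (ha ▸ Finset.mem_singleton_self a : a ∈ X.1.zeros \ Z.1.zeros)
      have hae : a ≠ e := by
        rintro rfl
        have hZa : Z.1 a ≠ 0 := by simpa using haX.2
        have hYa : Y.1 a ≠ 0 := by simpa using heY
        have hZY : Z.1 a = Y.1 a := eq_of_notMem_sep (by rw [hYZ.2]; simp) hYa hZa
        exact hZ.2.ne (neighbor_unique hXY hXZ.2 ha hZY).symm
      have haY : a ∈ Y.1.zeros := by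
        by_contra hc
        have : a ∈ X.1.zeros \ Y.1.zeros := Finset.mem_sdiff.2 ⟨haX.1, hc⟩
        rw [hY1, Finset.mem_singleton] at this
        exact hae this
      have hgZ : g ∈ Z.1.zeros := by
        by_contra hc
        have := Finset.card_le_one.1 hYZ.1.le a (Finset.mem_sdiff.2 ⟨haY, haX.2⟩) g
          (Finset.mem_sdiff.2 ⟨hgY.1, hc⟩)
        exact hgY.2 (this ▸ haX.1)
      refine ⟨a, ?_⟩
      rintro _ ⟨⟩ _ _
      refine ⟨Finset.mem_erase.2 ⟨hae, haX.1⟩, (Finset.eq_of_subset_of_card_le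
        (Finset.insert_subset hgZ (erase_subset_of_sdiff_eq_singleton ha)) ?_).symm⟩
      rw [Finset.card_insert_of_notMem (fun hc => hgY.2 (Finset.mem_of_mem_erase hc)),
        Finset.card_erase_add_one haX.1, h.card_zeros, h.card_zeros]
    · exact ⟨e, by rintro _ ⟨⟩⟩
    · exact ⟨e, by rintro _ ⟨⟩⟩
  choose a ha using hex
  have hlt : (X.1.zeros.erase e).card < k := by
    rw [← h.card_zeros X]; exact Finset.card_erase_lt_of_mem he
  refine lt_of_le_of_lt ?_ hlt
  rw [← Set.ncard_coe_finset]
  refine Set.ncard_le_ncard_of_injOn a (fun v hv => ?_) (fun v hv w hw hvw => ?_) (Set.toFinite _)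
  · obtain ⟨Z, hZ, hXZ, hYZ⟩ := hcommon v hv
    exact (ha v Z hZ hXZ hYZ).1
  · obtain ⟨Z, rfl, hXZ, hYZ⟩ := hcommon v hv
    obtain ⟨W, rfl, hXW, hYW⟩ := hcommon w hw
    have h1 := (ha _ Z rfl hXZ hYZ).2
    have h2 := (ha _ W rfl hXW hYW).2
    rw [hvw, ← h2] at h1
    rcases h.cocircuit_eq_or_eq_neg h1 with rfl | rfl
    · rfl
    exfalso
    obtain ⟨b, hb⟩ : ∃ b, b ∉ insert g X.1.zeros := by
      by_contra hcon
      push Not at hcon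
      have h3 := Finset.card_insert_le g X.1.zeros
      rw [Finset.eq_univ_of_forall hcon, Finset.card_univ, h.card_zeros] at h3
      omega
    rw [Finset.mem_insert, not_or] at hb
    have hbX : X.1 b ≠ 0 := by simpa using hb.2
    have hbZ : Z.1 b ≠ 0 := by
      rw [Ne, ← mem_zeros, (ha _ Z rfl hXZ hYZ).2, Finset.mem_insert, not_or]
      exact ⟨hb.1, fun hc => hb.2 (Finset.mem_of_mem_erase hc)⟩
    have h4 := eq_of_notMem_sep (X := X.1) (Y := Z.1) (by rw [(h.adj_iff.1 hXZ).2]; simp) hbX hbZ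
    have h5 := eq_of_notMem_sep (X := X.1) (Y := (-Z : M.cocircuits).1)
      (by rw [(h.adj_iff.1 hXW).2]; simp) hbX (by simpa using hbZ)
    rw [coe_neg_cocircuit, Pi.neg_apply, h4] at h5
    exact ne_neg_self hbX h5.symm

/-- If cocircuits vanish at all elements but one, then any two of them that are neither equal nor
antipodal are adjacent, and each is non-negative or non-positive. -/
theorem ncard_not_adj_le (h : M.IsGeneric k) (hcard : Fintype.card E = k + 1) (X : M.cocircuits) :
    {v | ¬M.G.Adj (.cocircuit X) v}.ncard ≤ 3 := by
  have hcompl : ∀ Y : M.cocircuits, ∃ a, ∀ b, b ∉ Y.1.zeros ↔ b = a := by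
    intro Y
    obtain ⟨a, ha⟩ := Finset.card_eq_one.1 (show (Y.1.zerosᶜ).card = 1 by
      rw [Finset.card_compl, h.card_zeros, hcard]; omega)
    exact ⟨a, fun b => by rw [← Finset.mem_compl, ha, Finset.mem_singleton]⟩
  obtain ⟨a, ha⟩ := hcompl X
  have ha0 : X.1 a ≠ 0 := by simpa using (ha a).2 rfl
  have hb0 : ∀ b, b ≠ a → X.1 b = 0 := fun b hb => by
    by_contra hc
    exact hb ((ha b).1 (by simpa using hc))
  have hadj : ∀ Y : M.cocircuits, Y ≠ X → Y ≠ -X → M.cocircuitGraph.Adj X Y := by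
    intro Y hY hY'
    obtain ⟨b, hb⟩ := hcompl Y
    have hab : b ≠ a := by
      rintro rfl
      have hz : X.1.zeros = Y.1.zeros := by
        ext c
        rw [← not_iff_not, ha, hb]
      rcases h.cocircuit_eq_or_eq_neg hz with h1 | h1
      · exact hY h1
      · exact hY' h1
    refine h.adj_iff.2 ⟨Finset.card_eq_one.2 ⟨b, ?_⟩, ?_⟩
    · ext c
      rw [Finset.mem_sdiff, hb, Finset.mem_singleton, mem_zeros]
      refine ⟨fun hc => hc.2, ?_⟩
      rintro rfl
      exact ⟨hb0 c hab, rfl⟩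
    · ext c
      simp only [mem_sep, Set.mem_empty_iff_false, iff_false, not_and, not_not]
      intro hc
      by_cases hca : c = a
      · rw [hc, hca]
        have : a ∈ Y.1.zeros := by
          by_contra hcon
          exact hab ((hb a).1 hcon).symm
        rw [mem_zeros.1 this]
        rfl
      · exact hb0 c hca
  have hsub : ∃ v, {v | ¬M.G.Adj (.cocircuit X) v} ⊆
      {.cocircuit X, .cocircuit (-X), v} := by
    have hpos : (∀ e, 0 ≤ X.1 e) ∨ ∀ e, X.1 e ≤ 0 := by
      have : ∀ x : SignType, 0 ≤ x ∨ x ≤ 0 := by decide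
      rcases this (X.1 a) with h1 | h1
      · refine Or.inl fun b => ?_
        by_cases hb : b = a
        · rwa [hb]
        · rw [hb0 b hb]
      · refine Or.inr fun b => ?_
        by_cases hb : b = a
        · rwa [hb]
        · rw [hb0 b hb]
    have hmem : ∀ (Y : M.cocircuits) (v : GVertex M), ¬M.cocircuitGraph.Adj X Y →
        GVertex.cocircuit Y ∈ ({.cocircuit X, .cocircuit (-X), v} : Set (GVertex M)) := by
      intro Y v hY
      by_cases h1 : Y = X
      · exact Or.inl (by rw [h1])
      by_cases h2 : Y = -X
      · exact Or.inr (Or.inl (by rw [h2]))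
      exact absurd (hadj Y h1 h2) hY
    rcases hpos with hp | hp
    · refine ⟨.vminus, ?_⟩
      rintro (Y | _ | _) hv
      · exact hmem Y _ hv
      · exact absurd hp hv
      · simp
    · refine ⟨.vplus, ?_⟩
      rintro (Y | _ | _) hv
      · exact hmem Y _ hv
      · simp
      · exact absurd hp hv
  obtain ⟨v, hv⟩ := hsub
  refine (Set.ncard_le_ncard hv (Set.toFinite _)).trans ?_
  refine (Set.ncard_insert_le _ _).trans (Nat.succ_le_succ ?_)
  refine (Set.ncard_insert_le _ _).trans (Nat.succ_le_succ ?_)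
  rw [Set.ncard_singleton]

end IsGeneric

end OrientedMatroid

/-! ### Isomorphisms of the graphs `G(M)` -/

section Iso

variable {V W : Type*} {G : SimpleGraph V} {H : SimpleGraph W}

theorem SimpleGraph.Iso.ncard_neighborSet (f : G ≃g H) (v : V) :
    (H.neighborSet (f v)).ncard = (G.neighborSet v).ncard := by
  rw [← Set.ncard_image_of_injective _ f.injective]
  congr 1
  ext w
  obtain ⟨w, rfl⟩ := f.surjective w
  rw [f.injective.mem_set_image, SimpleGraph.mem_neighborSet, SimpleGraph.mem_neighborSet,
    f.map_adj_iff]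

theorem SimpleGraph.Iso.ncard_commonNeighbors (f : G ≃g H) (u v : V) :
    (H.commonNeighbors (f u) (f v)).ncard = (G.commonNeighbors u v).ncard := by
  rw [← Set.ncard_image_of_injective _ f.injective]
  congr 1
  ext w
  obtain ⟨w, rfl⟩ := f.surjective w
  rw [f.injective.mem_set_image, SimpleGraph.mem_commonNeighbors, SimpleGraph.mem_commonNeighbors,
    f.map_adj_iff, f.map_adj_iff]

theorem SimpleGraph.Iso.ncard_not_adj (f : G ≃g H) (v : V) :
    {w | ¬H.Adj (f v) w}.ncard = {w | ¬G.Adj v w}.ncard := by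
  rw [← Set.ncard_image_of_injective _ f.injective]
  congr 1
  ext w
  obtain ⟨w, rfl⟩ := f.surjective w
  rw [f.injective.mem_set_image, Set.mem_ofPred_eq, Set.mem_ofPred_eq, f.map_adj_iff]

end Iso

namespace OrientedMatroid

open SignVec

variable {E F : Type*} {M : OrientedMatroid E} {N : OrientedMatroid F} {k l : ℕ}

theorem exists_apply_cocircuit (f : M.G ≃g N.G) (hp : f .vplus = .vplus) (hm : f .vminus = .vminus)
    (X : M.cocircuits) : ∃ Y : N.cocircuits, f (.cocircuit X) = .cocircuit Y := by
  rcases hY : f (.cocircuit X) with Y | _ | _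
  · exact ⟨Y, rfl⟩
  · exact absurd (f.injective (hY.trans hp.symm)) (by simp)
  · exact absurd (f.injective (hY.trans hm.symm)) (by simp)

namespace IsGeneric

theorem exists_nonneg [Fintype E] (h : M.IsGeneric k) (hacyc : M.IsAcyclic) :
    ∃ X : M.cocircuits, ∀ e, 0 ≤ X.1 e := by
  obtain ⟨e⟩ : Nonempty E := Fintype.card_pos_iff.1 ((Nat.zero_le k).trans_lt h.lt_card)
  obtain ⟨X, hX, hXc, -⟩ := h.exists_cocircuit_conf hacyc (e := e) one_ne_zero
  exact ⟨⟨X, hX⟩, fun f => by rcases hXc f with h | h <;> simp [h]⟩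

variable [Fintype E] [DecidableEq E] [Fintype F] [DecidableEq F]

/-- Since `M` is acyclic, `v₊` lies on a triangle. -/
theorem exists_triangle (h : M.IsGeneric k) (hk : 0 < k) (hacyc : M.IsAcyclic) :
    ∃ X Y : M.cocircuits, (∀ e, 0 ≤ X.1 e) ∧ (∀ e, 0 ≤ Y.1 e) ∧ M.cocircuitGraph.Adj X Y := by
  obtain ⟨X, hX⟩ := h.exists_nonneg hacyc
  have h1 := (hk.trans_le (h.le_ncard_commonNeighbors hX))
  rw [Set.ncard_pos (Set.toFinite _)] at h1
  obtain ⟨Y | _ | _, hY⟩ := h1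
  · exact ⟨X, Y, hX, hY.1, hY.2⟩
  · exact hY.1.elim
  · exact hY.1.elim

/-- No isomorphism sends `v₊` to a cocircuit: neighbours of `v₊` have small degree and many common
neighbours with `v₊`, and `v₊` itself has at least four non-neighbours. -/
theorem apply_vplus_ne_cocircuit (hM : M.IsGeneric k) (hN : N.IsGeneric l) (hk : 0 < k)
    (hl : 0 < l) (hacyc : M.IsAcyclic) (f : M.G ≃g N.G) (X : N.cocircuits) :
    f .vplus ≠ .cocircuit X := by
  intro hf
  rcases (Nat.succ_le_of_lt hN.lt_card).eq_or_lt with hcard | hcard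
  · obtain ⟨Y, Z, hY, hZ, hYZ⟩ := hM.exists_triangle hk hacyc
    have h1 := hN.ncard_not_adj_le hcard.symm X
    rw [← hf, f.ncard_not_adj] at h1
    have hneg : ∀ Y : M.cocircuits, (∀ e, 0 ≤ Y.1 e) → ¬∀ e, 0 ≤ (-Y : M.cocircuits).1 e := by
      intro Y hY hc
      refine not_nonpos_of_nonneg hY fun e => ?_
      have := hc e
      rw [coe_neg_cocircuit, Pi.neg_apply] at this
      revert this
      generalize Y.1 e = x
      revert x
      decide
    have hsub : ({GVertex.vplus, .vminus, .cocircuit (-Y), .cocircuit (-Z)} : Set (GVertex M)) ⊆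
        {w | ¬M.G.Adj .vplus w} := by
      rintro _ (rfl | rfl | rfl | rfl)
      · exact id
      · exact id
      · exact hneg Y hY
      · exact hneg Z hZ
    have h2 := Set.ncard_le_ncard hsub (Set.toFinite _)
    rw [Set.ncard_insert_of_notMem (by simp), Set.ncard_insert_of_notMem (by simp),
      Set.ncard_pair (by simpa using hYZ.ne)] at h2
    omega
  · obtain ⟨Y, hXY, hY⟩ := hN.exists_ncard_commonNeighbors_lt hl hcard X
    obtain ⟨v, hv⟩ := f.surjective (.cocircuit Y)
    have hadj : M.G.Adj .vplus v := by rw [← f.map_adj_iff, hf, hv]; exact hXY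
    rcases v with Z | _ | _
    · have h1 := hM.ncard_G_neighborSet_le hadj
      have h2 := hM.le_ncard_commonNeighbors hadj
      have h3 := hN.le_ncard_G_neighborSet Y
      rw [← hv, f.ncard_neighborSet] at h3
      rw [← hf, ← hv, f.ncard_commonNeighbors] at hY
      omega
    · exact hadj.elim
    · exact hadj.elim

/-- An isomorphism of the extended graphs restricts, possibly after negation, to an isomorphism of
cocircuit graphs that respects non-negativity and non-positivity. -/
theorem exists_iso_cocircuitGraph (hM : M.IsGeneric k) (hN : N.IsGeneric l) (hk : 0 < k)
    (hl : 0 < l) (hacyc : M.IsAcyclic) (f : M.G ≃g N.G) :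
    ∃ g : M.cocircuitGraph ≃g N.cocircuitGraph,
      (∀ X, (∀ e, 0 ≤ X.1 e) ↔ ∀ e, 0 ≤ (g X).1 e) ∧
      ∀ X, (∀ e, X.1 e ≤ 0) ↔ ∀ e, (g X).1 e ≤ 0 := by
  have hvp : ∀ X, f .vplus ≠ .cocircuit X := hM.apply_vplus_ne_cocircuit hN hk hl hacyc f
  have hvm : ∀ X, f .vminus ≠ .cocircuit X :=
    hM.apply_vplus_ne_cocircuit hN hk hl hacyc (hM.flip.trans f)
  obtain ⟨f', hp, hm⟩ : ∃ f' : M.G ≃g N.G, f' .vplus = .vplus ∧ f' .vminus = .vminus := by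
    rcases h1 : f .vplus with X | _ | _
    · exact absurd h1 (hvp X)
    · rcases h2 : f .vminus with X | _ | _
      · exact absurd h2 (hvm X)
      · exact absurd (f.injective (h1.trans h2.symm)) (by simp)
      · exact ⟨f, h1, h2⟩
    · rcases h2 : f .vminus with X | _ | _
      · exact absurd h2 (hvm X)
      · exact ⟨hM.flip.trans f, h2, h1⟩
      · exact absurd (f.injective (h1.trans h2.symm)) (by simp)
  clear hvp hvm f
  have hp' : f'.symm .vplus = .vplus := by rw [← hp, f'.symm_apply_apply]
  have hm' : f'.symm .vminus = .vminus := by rw [← hm, f'.symm_apply_apply]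
  choose g hg using exists_apply_cocircuit f' hp hm
  choose g' hg' using exists_apply_cocircuit f'.symm hp' hm'
  refine ⟨⟨⟨g, g', fun X => ?_, fun X => ?_⟩, fun {X Y} => ?_⟩, fun X => ?_, fun X => ?_⟩
  · refine GVertex.cocircuit.inj ?_
    rw [← hg', ← hg, f'.symm_apply_apply]
  · refine GVertex.cocircuit.inj ?_
    rw [← hg, ← hg', f'.apply_symm_apply]
  · change N.G.Adj (.cocircuit (g X)) (.cocircuit (g Y)) ↔ M.G.Adj (.cocircuit X) (.cocircuit Y)
    rw [← hg, ← hg, f'.map_adj_iff]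
  · change M.G.Adj .vplus (.cocircuit X) ↔ N.G.Adj .vplus (.cocircuit (g X))
    rw [← hg, ← hp, f'.map_adj_iff]
  · change M.G.Adj .vminus (.cocircuit X) ↔ N.G.Adj .vminus (.cocircuit (g X))
    rw [← hg, ← hm, f'.map_adj_iff]

/-- The isomorphism can be made compatible with the antipodal maps without losing compatibility
with non-negativity: `antipodeMul` is a product of two maps that exchange non-negative and
non-positive cocircuits. -/
theorem exists_antipodal (hM : M.IsGeneric k) (hN : N.IsGeneric l) (hk : 0 < k)
    (hl : 0 < l) (hle : Fintype.card F + k ≤ Fintype.card E + l)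
    (f : M.cocircuitGraph ≃g N.cocircuitGraph)
    (hpos : ∀ X, (∀ e, 0 ≤ X.1 e) ↔ ∀ e, 0 ≤ (f X).1 e)
    (hneg : ∀ X, (∀ e, X.1 e ≤ 0) ↔ ∀ e, (f X).1 e ≤ 0) :
    ∃ g : M.cocircuitGraph ≃g N.cocircuitGraph, (∀ X, g (-X) = -g X) ∧
      ∀ X, (∀ e, 0 ≤ X.1 e) ↔ ∀ e, 0 ≤ (g X).1 e := by
  obtain ⟨i, hi⟩ := hM.exists_antipodal_of_le hN hk hl f hle
  set t := antipodeMul hM hN f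
  have ht : ∀ X, t X = f (-f.symm (-X)) := fun X => rfl
  have hflip : ∀ x : SignType, 0 ≤ -x ↔ x ≤ 0 := by decide
  have hflip' : ∀ x : SignType, -x ≤ 0 ↔ 0 ≤ x := by decide
  have htpos : ∀ X, (∀ e, 0 ≤ (t X).1 e) ↔ ∀ e, 0 ≤ X.1 e := by
    intro X
    have h1 : (∀ e, 0 ≤ (-f.symm (-X)).1 e) ↔ ∀ e, (f.symm (-X)).1 e ≤ 0 :=
      forall_congr' fun e => hflip _
    have h2 : (∀ e, (-X : N.cocircuits).1 e ≤ 0) ↔ ∀ e, 0 ≤ X.1 e :=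
      forall_congr' fun e => hflip' _
    rw [ht, ← hpos, h1, hneg, f.apply_symm_apply, h2]
  have hpow : ∀ (j : ℕ) X, (∀ e, 0 ≤ ((t ^ j) X).1 e) ↔ ∀ e, 0 ≤ X.1 e := by
    intro j
    induction j with
    | zero => exact fun X => Iff.rfl
    | succ j ih =>
      intro X
      rw [pow_succ, RelIso.mul_apply, ih, htpos]
  refine ⟨f.trans (t ^ i)⁻¹, hi, fun X => ?_⟩
  change _ ↔ ∀ e, 0 ≤ ((t ^ i)⁻¹ (f X)).1 e
  rw [← hpow i ((t ^ i)⁻¹ (f X)), RelIso.apply_inv_self, hpos]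

theorem relabelingEquiv_of_iso (hM : M.IsGeneric k) (hN : N.IsGeneric l) (hk : 0 < k)
    (hl : 0 < l) (hacyc : M.IsAcyclic) (f : M.G ≃g N.G) : M.RelabelingEquiv N := by
  obtain ⟨f, hpos, hneg⟩ := hM.exists_iso_cocircuitGraph hN hk hl hacyc f
  obtain ⟨g, hg, hgpos⟩ : ∃ g : M.cocircuitGraph ≃g N.cocircuitGraph, (∀ X, g (-X) = -g X) ∧
      ∀ X, (∀ e, 0 ≤ X.1 e) ↔ ∀ e, 0 ≤ (g X).1 e := by
    rcases le_total (Fintype.card F + k) (Fintype.card E + l) with hle | hle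
    · exact hM.exists_antipodal hN hk hl hle f hpos hneg
    · obtain ⟨g, hg, hgpos⟩ := hN.exists_antipodal hM hl hk hle f.symm
        (fun X => by rw [hpos, f.apply_symm_apply]) (fun X => by rw [hneg, f.apply_symm_apply])
      refine ⟨g.symm, fun X => ?_, fun X => by rw [hgpos, g.apply_symm_apply]⟩
      rw [g.symm_apply_eq, hg, g.apply_symm_apply]
  obtain ⟨φ, hφ⟩ := hM.exists_mapSign_eq hN hk hl hacyc g hg fun X => (hgpos X).1
  exact hM.relabelingEquiv hN g hφ

end IsGeneric

theorem mapSign_symm_mapSign (φ : E ≃ F) (X : SignVec E) : mapSign φ.symm (mapSign φ X) = X := by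
  funext e
  simp [mapSign]

theorem mapSign_mapSign_symm (φ : E ≃ F) (X : SignVec F) : mapSign φ (mapSign φ.symm X) = X :=
  mapSign_symm_mapSign φ.symm X

theorem mapSign_eq_zero {φ : E ≃ F} {X : SignVec E} : mapSign φ X = 0 ↔ X = 0 := by
  refine ⟨fun h => ?_, fun h => by rw [h]; rfl⟩
  rw [← mapSign_symm_mapSign φ X, h]
  rfl

theorem conf_mapSign {φ : E ≃ F} {X Y : SignVec E} :
    (mapSign φ X).Conf (mapSign φ Y) ↔ X.Conf Y :=
  φ.symm.forall_congr_right (q := fun e => X e = Y e ∨ X e = 0)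

theorem mapSign_mem_cocircuits {φ : E ≃ F}
    (hφ : ∀ X : SignVec E, X ∈ M.covectors ↔ mapSign φ X ∈ N.covectors) {X : SignVec E} :
    X ∈ M.cocircuits ↔ mapSign φ X ∈ N.cocircuits := by
  have hall : ∀ p : SignVec F → Prop, (∀ Y, p Y) ↔ ∀ Y, p (mapSign φ Y) := fun p =>
    ⟨fun h Y => h _, fun h Y => mapSign_mapSign_symm φ Y ▸ h _⟩
  have hinj : ∀ Y Z : SignVec E, mapSign φ Y = mapSign φ Z ↔ Y = Z := fun Y Z =>
    ⟨fun h => by rw [← mapSign_symm_mapSign φ Y, h, mapSign_symm_mapSign], fun h => by rw [h]⟩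
  change _ ∧ _ ∧ _ ↔ _ ∧ _ ∧ _
  rw [hall]
  simp only [← hφ, Ne, mapSign_eq_zero, conf_mapSign, hinj]

theorem RelabelingEquiv.nonempty_iso (h : M.RelabelingEquiv N) : Nonempty (M.G ≃g N.G) := by
  obtain ⟨φ, hφ⟩ := h
  have hψ : ∀ X : SignVec F, X ∈ N.covectors ↔ mapSign φ.symm X ∈ M.covectors := fun X => by
    rw [hφ, mapSign_mapSign_symm]
  let e : M.cocircuits ≃ N.cocircuits :=
    { toFun := fun X => ⟨mapSign φ X.1, (mapSign_mem_cocircuits hφ).1 X.2⟩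
      invFun := fun X => ⟨mapSign φ.symm X.1, (mapSign_mem_cocircuits hψ).1 X.2⟩
      left_inv := fun X => Subtype.ext (mapSign_symm_mapSign φ X.1)
      right_inv := fun X => Subtype.ext (mapSign_mapSign_symm φ X.1) }
  have hadj : ∀ X Y, N.cocircuitGraph.Adj (e X) (e Y) ↔ M.cocircuitGraph.Adj X Y := by
    intro X Y
    change _ ∧ _ ∧ _ ↔ _ ∧ _ ∧ _
    refine and_congr e.injective.ne_iff (and_congr ?_ ?_)
    · rw [Set.eq_empty_iff_forall_notMem, Set.eq_empty_iff_forall_notMem]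
      exact φ.symm.forall_congr_right (q := fun a => a ∉ X.1.sep Y.1)
    · rw [← e.forall_congr_right]
      refine forall_congr' fun Z => ?_
      rw [e.injective.ne_iff, e.injective.ne_iff]
      have : SignVec.Conf (e Z).1 (SignVec.comp (e X).1 (e Y).1) ↔
          SignVec.Conf Z.1 (SignVec.comp X.1 Y.1) :=
        φ.symm.forall_congr_right (q := fun a => Z.1 a = X.1.comp Y.1 a ∨ Z.1 a = 0)
      rw [this]
  refine ⟨{
    toFun := fun
      | .cocircuit X => .cocircuit (e X)
      | .vplus => .vplus
      | .vminus => .vminus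
    invFun := fun
      | .cocircuit X => .cocircuit (e.symm X)
      | .vplus => .vplus
      | .vminus => .vminus
    left_inv := by rintro (X | _ | _) <;> simp
    right_inv := by rintro (X | _ | _) <;> simp
    map_rel_iff' := ?_ }⟩
  rintro (X | _ | _) (Y | _ | _)
  · exact hadj X Y
  · exact φ.symm.forall_congr_right (q := fun a => 0 ≤ X.1 a)
  · exact φ.symm.forall_congr_right (q := fun a => X.1 a ≤ 0)
  · exact φ.symm.forall_congr_right (q := fun a => 0 ≤ Y.1 a)
  · exact Iff.rfl
  · exact Iff.rfl
  · exact φ.symm.forall_congr_right (q := fun a => Y.1 a ≤ 0)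
  · exact Iff.rfl
  · exact Iff.rfl

end OrientedMatroid

theorem mainTheorem6 {E F : Type*} [Finite E] [Finite F]
    (M : OrientedMatroid E) (N : OrientedMatroid F)
    (hM : M.IsUniform) (hN : N.IsUniform)
    (hacyc : M.IsAcyclic) (hrank : 2 ≤ M.rank) :
    M.RelabelingEquiv N ↔ Nonempty (M.G ≃g N.G) := by
  refine ⟨OrientedMatroid.RelabelingEquiv.nonempty_iso, ?_⟩
  rintro ⟨f⟩
  classical
  cases nonempty_fintype E
  cases nonempty_fintype F
  have hfin : M.rank ≠ ⊤ := by
    refine ne_top_of_le_ne_top ?_ (Matroid.eRank_le_encard_ground M.underlying)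
    exact Set.encard_ne_top_iff.2 (Set.toFinite _)
  obtain ⟨r, hr⟩ := ENat.ne_top_iff_exists.1 hfin
  have hr2 : 2 ≤ r := by rw [← hr] at hrank; exact_mod_cast hrank
  obtain ⟨k, rfl⟩ : ∃ k, r = k + 1 := ⟨r - 1, by omega⟩
  have hk : 0 < k := by omega
  have hMk := hM.isGeneric hr.symm
  obtain ⟨X, Y, hX, hY, hXY⟩ := hMk.exists_triangle hk hacyc
  obtain ⟨X', Y', hXY'⟩ := OrientedMatroid.exists_adj_of_triangle
    (f.map_adj_iff.2 (show M.G.Adj .vplus (.cocircuit X) from hX))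
    (f.map_adj_iff.2 (show M.G.Adj .vplus (.cocircuit Y) from hY))
    (f.map_adj_iff.2 (show M.G.Adj (.cocircuit X) (.cocircuit Y) from hXY))
  obtain ⟨l, hl⟩ := hN.exists_rank_eq X'
  have hNl := hN.isGeneric hl
  exact hMk.relabelingEquiv_of_iso hNl hk (hNl.pos_of_adj hXY') hacyc f
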